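/- Let $\hbar>0$. On the $m$-mode Fock space, with annihilation operators $a_j$, let $Q_j=\sqrt{\hbar/2}\,(a_j+a_j^\dagger)$, $P_j=-i\sqrt{\hbar/2}\,(a_j-a_j^\dagger)$ and $R=(Q_1,\dots,Q_m,P_1,\dots,P_m)$. The mean and covariance matrix of a state $\rho$ are $\mu_i=\mathrm{Tr}[\rho R_i]$ and $\Sigma_{ij}=\frac12\mathrm{Tr}[\rho\{R_i-\mu_i,R_j-\mu_j\}]$. A Gaussian state is a density operator $\rho$ whose Bargmann function $F_\rho(w,z)=e^{(\|w\|^2+\|z\|^2)/2}\langle z^*|\rho|w\rangle$ (with $|\alpha\rangle$ the coherent states) is of the form $c\exp(\frac12\zeta^{\mathrm T}A\zeta+\zeta^{\mathrm T}b)$, $\zeta=(w,z)$, with $A$ complex symmetric. Let $\Phi$ be an $m$-mode Gaussian channel, that is, a completely positive trace-preserving linear map on the trace-class operators whose Bargmann function $$F_\Phi(w,z,w',z')=e^{\frac12(\|w\|^2+\|z\|^2+\|w'\|^2+\|z'\|^2)}\,\langle z^*|\,\Phi\big(|z'\rangle\langle w'^*|\big)\,|w\rangle,\qquad w,z,w',z'\in\mathbb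 C^m,$$ is equal to $c\exp(\frac12\zeta^{\mathrm T}A_\Phi\zeta+\zeta^{\mathrm T}b)$ with $\zeta=(w,z,w',z')$ and a complex symmetric matrix $$A_\Phi=\begin{bmatrix}A^{\mathrm{out}}_\Phi&\Gamma_\Phi^{\mathrm T}\\ \Gamma_\Phi&A^{\mathrm{in}}_\Phi\end{bmatrix}$$ with blocks of size $2m\times2m$. Let $(X_\Phi,Y_\Phi,d_\Phi)$ be the real phase-space form of $\Phi$: for every Gaussian state $\rho$ with mean $\mu$ and covariance matrix $\Sigma$, the state $\Phi(\rho)$ has mean $X_\Phi\mu+d_\Phi$ and covariance matrix $X_\Phi\Sigma X_\Phi^{\mathrm T}+Y_\Phi$. Put $$X=\begin{bmatrix}0&\mathbb 1\\ \mathbb 1&0\end{bmatrix},\qquad W=\frac1{\sqrt2}\begin{bmatrix}\mathbb 1&i\mathbb 1\\ \mathbb 1&-i\mathbb 1\end{bmatrix}.$$ Then $\mathbb 1-XA^{\mathrm{out}}_\Phi$ is invertible and $$X_\Phi=W^\dagger(\mathbb 1-XA^{\mathrm{out}}_\Phi)^{-1}X\,\Gamma_\Phi^{\mathrm T}\,XW,\qquad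 \frac1\hbar Y_\Phi=W^\dagger(\mathbb 1-XA^{\mathrm{out}}_\Phi)^{-1}W-\frac12\left(\mathbb 1+X_\Phi X_\Phi^{\mathrm T}\right).$$ -/

import Mathlib

open scoped Matrix ComplexOrder

namespace Bargmann

noncomputable section

/-! ### The `m`-mode Fock space and its number and coherent states -/

/-- The Hilbert space of `m` bosonic modes: square-summable functions of the photon numbers. -/
abbrev FockSpace (m : ℕ) : Type := lp (fun _ : Fin m → ℕ => ℂ) 2

/-- The number state `|k⟩ = |k₁, …, k_m⟩`. -/
def numberKet {m : ℕ} (k : Fin m → ℕ) : FockSpace m := lp.single 2 k (1 : ℂ)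

/-- The amplitude `⟨k|α⟩` of the coherent state `|α⟩`. -/
def coherentAmplitude {m : ℕ} (α : Fin m → ℂ) (k : Fin m → ℕ) : ℂ :=
  (Real.exp (-(∑ j, ‖α j‖ ^ 2) / 2) : ℂ) *
    ∏ j, α j ^ k j / (Real.sqrt ((k j).factorial : ℝ) : ℂ)

theorem summable_pi_prod {m : ℕ} (f : Fin m → ℕ → ℝ) (h0 : ∀ j i, 0 ≤ f j i)
    (hf : ∀ j, Summable (f j)) : Summable (fun k : Fin m → ℕ => ∏ j, f j (k j)) := by
  classical
  refine summable_of_sum_le (c := ∏ j, ∑' i, f j i)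
    (fun k => Finset.prod_nonneg fun j _ => h0 j _) ?_
  intro s
  let t : Fin m → Finset ℕ := fun j => s.image (fun k => k j)
  calc ∑ k ∈ s, ∏ j, f j (k j) ≤ ∑ k ∈ Fintype.piFinset t, ∏ j, f j (k j) := by
        refine Finset.sum_le_sum_of_subset_of_nonneg ?_
          (fun k _ _ => Finset.prod_nonneg fun j _ => h0 j _)
        intro k hk
        exact Fintype.mem_piFinset.2 fun j => Finset.mem_image_of_mem _ hk
    _ = ∏ j, ∑ i ∈ t j, f j i := (Finset.prod_univ_sum t f).symm
    _ ≤ ∏ j, ∑' i, f j i := by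
        refine Finset.prod_le_prod (fun j _ => Finset.sum_nonneg fun i _ => h0 j i) ?_
        intro j _
        exact (hf j).sum_le_tsum _ (fun i _ => h0 j i)

theorem memlp_coherentAmplitude {m : ℕ} (α : Fin m → ℂ) :
    Memℓp (E := fun _ : Fin m → ℕ => ℂ) (coherentAmplitude α) 2 := by
  refine memℓp_gen ?_
  have h : Summable (fun k : Fin m → ℕ => ∏ j, (‖α j‖ ^ 2) ^ k j / ((k j).factorial : ℝ)) :=
    summable_pi_prod (fun j i => (‖α j‖ ^ 2) ^ i / (i.factorial : ℝ))
      (fun j i => by positivity) (fun j => Real.summable_pow_div_factorial _)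
  refine (h.mul_left ((Real.exp (-(∑ j, ‖α j‖ ^ 2) / 2)) ^ 2)).congr ?_
  intro k
  have e : ∀ j : Fin m, (‖α j‖ ^ 2) ^ k j / ((k j).factorial : ℝ)
      = (‖α j‖ ^ k j / Real.sqrt ((k j).factorial : ℝ)) ^ 2 := by
    intro j
    rw [div_pow, Real.sq_sqrt (by positivity), ← pow_mul, ← pow_mul, mul_comm]
  simp only [coherentAmplitude, e, norm_mul, norm_prod, norm_div, norm_pow, Complex.norm_real,
    Real.norm_eq_abs, Real.abs_exp, abs_of_nonneg (Real.sqrt_nonneg _)]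
  rw [Finset.prod_pow, ← mul_pow]
  norm_num

/-- The normalized coherent state `|α⟩`. -/
def coherentKet {m : ℕ} (α : Fin m → ℂ) : FockSpace m :=
  ⟨coherentAmplitude α, memlp_coherentAmplitude α⟩

/-! ### Trace-class operators, density operators and quantum channels -/

/-- The positive bounded operators of finite trace. -/
def positiveTraceClass (m : ℕ) : Set (FockSpace m →L[ℂ] FockSpace m) :=
  {T | T.IsPositive ∧
    Summable fun k : Fin m → ℕ => (inner ℂ (numberKet k) (T (numberKet k)) : ℂ)}

/-- The trace-class operators: linear combinations of positive operators of finite trace. -/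
def TraceClass (m : ℕ) : Submodule ℂ (FockSpace m →L[ℂ] FockSpace m) :=
  Submodule.span ℂ (positiveTraceClass m)

/-- The trace of a trace-class operator. -/
def trace {m : ℕ} (T : TraceClass m) : ℂ :=
  ∑' k : Fin m → ℕ, inner ℂ (numberKet k) (T.1 (numberKet k))

/-- Density operators: positive operators of trace one. -/
def IsDensity {m : ℕ} (ρ : TraceClass m) : Prop :=
  ρ.1.IsPositive ∧ trace ρ = 1

theorem summable_norm_sq {m : ℕ} (u : FockSpace m) :
    Summable fun k : Fin m → ℕ => ‖u k‖ ^ 2 := by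
  have h := (lp.memℓp u).summable (by norm_num)
  simpa using h

theorem inner_numberKet {m : ℕ} (k : Fin m → ℕ) (u : FockSpace m) :
    (inner ℂ (numberKet k) u : ℂ) = u k := by
  rw [numberKet, lp.inner_single_left]
  simp

theorem rankOne_self_mem {m : ℕ} (u : FockSpace m) :
    InnerProductSpace.rankOne ℂ u u ∈ TraceClass m := by
  refine Submodule.subset_span ⟨InnerProductSpace.isPositive_rankOne_self u, ?_⟩
  have h2 : Summable fun k : Fin m → ℕ => ((‖u k‖ ^ 2 : ℝ) : ℂ) :=
    Complex.ofRealCLM.summable (summable_norm_sq u)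
  refine h2.congr fun k => ?_
  rw [InnerProductSpace.rankOne_apply, inner_smul_right, ← inner_conj_symm u, inner_numberKet,
    mul_comm, Complex.mul_conj, Complex.normSq_eq_norm_sq]

theorem rankOne_polarization {E : Type*} [NormedAddCommGroup E] [InnerProductSpace ℂ E] (u v : E) :
    InnerProductSpace.rankOne ℂ u v =
      (1 / 4 : ℂ) • (InnerProductSpace.rankOne ℂ (u + v) (u + v)
        - InnerProductSpace.rankOne ℂ (u - v) (u - v)
        + Complex.I • InnerProductSpace.rankOne ℂ (u + Complex.I • v) (u + Complex.I • v)
        - Complex.I • InnerProductSpace.rankOne ℂ (u - Complex.I • v) (u - Complex.I • v)) := by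
  ext x
  simp only [InnerProductSpace.rankOne_apply, smul_apply, add_apply, sub_apply, inner_add_left,
    inner_sub_left, inner_smul_left, Complex.conj_I]
  match_scalars <;> ring_nf <;> simp only [Complex.I_sq] <;> ring

theorem rankOne_mem {m : ℕ} (u v : FockSpace m) :
    InnerProductSpace.rankOne ℂ u v ∈ TraceClass m := by
  rw [rankOne_polarization]
  exact Submodule.smul_mem _ _ (Submodule.sub_mem _ (Submodule.add_mem _ (Submodule.sub_mem _
    (rankOne_self_mem _) (rankOne_self_mem _)) (Submodule.smul_mem _ _ (rankOne_self_mem _)))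
    (Submodule.smul_mem _ _ (rankOne_self_mem _)))

/-- The operator `|u⟩⟨v|`. -/
def ketBra {m : ℕ} (u v : FockSpace m) : TraceClass m :=
  ⟨InnerProductSpace.rankOne ℂ u v, rankOne_mem u v⟩

/-- Positivity of the block operator `(T i j)` on the direct sum of `n` copies of Fock space. -/
def BlockPositive {m n : ℕ} (T : Matrix (Fin n) (Fin n) (TraceClass m)) : Prop :=
  ∀ ψ : Fin n → FockSpace m, (0 : ℂ) ≤ ∑ i, ∑ j, inner ℂ (ψ i) ((T i j).1 (ψ j))

/-- Quantum channels on `m` modes: completely positive trace-preserving linear maps on the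
trace-class operators. -/
structure QuantumChannel (m : ℕ) where
  toLinearMap : TraceClass m →ₗ[ℂ] TraceClass m
  completelyPositive : ∀ (n : ℕ) (T : Matrix (Fin n) (Fin n) (TraceClass m)),
    BlockPositive T → BlockPositive (T.map toLinearMap)
  tracePreserving : ∀ T : TraceClass m, trace (toLinearMap T) = trace T

/-! ### Bargmann functions and Gaussian objects -/

/-- The Gaussian function `c exp(ζᵀ A ζ / 2 + ζᵀ b)`. -/
def gaussianFun {ι : Type} [Fintype ι] (A : Matrix ι ι ℂ) (b : ι → ℂ) (c : ℂ) (ζ : ι → ℂ) : ℂ :=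
  c * Complex.exp (1 / 2 * (ζ ⬝ᵥ (A *ᵥ ζ)) + ζ ⬝ᵥ b)

/-- The factor `exp(‖z‖² / 2)`. -/
def bargmannFactor {m : ℕ} (z : Fin m → ℂ) : ℂ :=
  (Real.exp ((∑ j, ‖z j‖ ^ 2) / 2) : ℂ)

/-- The Bargmann function `F_T(w, z) = exp((‖w‖² + ‖z‖²) / 2) ⟨z*| T |w⟩` of an operator. -/
def bargmannOp {m : ℕ} (T : TraceClass m) (w z : Fin m → ℂ) : ℂ :=
  bargmannFactor w * bargmannFactor z * inner ℂ (coherentKet (star z)) (T.1 (coherentKet w))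

/-- The Bargmann function of a map on operators,
`F_Φ(w, z, w', z') = exp((‖w‖² + ‖z‖² + ‖w'‖² + ‖z'‖²) / 2) ⟨z*| Φ(|z'⟩⟨w'*|) |w⟩`. -/
def bargmannMap {m : ℕ} (Φ : TraceClass m →ₗ[ℂ] TraceClass m) (w z w' z' : Fin m → ℂ) : ℂ :=
  bargmannFactor w' * bargmannFactor z' *
    bargmannOp (Φ (ketBra (coherentKet z') (coherentKet (star w')))) w z

/-- Index set of `2m` components: the bra and ket variables `(w, z)` of `m` modes in the Bargmann
picture, the positions and momenta `(q, p)` in phase space. -/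
abbrev Ix (m : ℕ) : Type := Fin m ⊕ Fin m

/-- Gaussian states: density operators whose Bargmann function is a Gaussian function. -/
def IsGaussianState {m : ℕ} (ρ : TraceClass m) : Prop :=
  IsDensity ρ ∧ ∃ (A : Matrix (Ix m) (Ix m) ℂ) (b : Ix m → ℂ) (c : ℂ), A.IsSymm ∧
    ∀ w z, bargmannOp ρ w z = gaussianFun A b c (Sum.elim w z)

/-- `Φ` is a Gaussian channel with parameters `(A, b, c)`, in the output-input order
`(w, z, w', z')` of the variables. -/
def QuantumChannel.HasAbc {m : ℕ} (Φ : QuantumChannel m)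
    (A : Matrix (Ix m ⊕ Ix m) (Ix m ⊕ Ix m) ℂ) (b : Ix m ⊕ Ix m → ℂ) (c : ℂ) : Prop :=
  A.IsSymm ∧ ∀ w z w' z', bargmannMap Φ.toLinearMap w z w' z' =
    gaussianFun A b c (Sum.elim (Sum.elim w z) (Sum.elim w' z'))

/-! ### Quadratures, means and covariances -/

/-- The span of the number states, on which polynomials in the quadratures act. -/
abbrev FiniteFock (m : ℕ) : Type := (Fin m → ℕ) →₀ ℂ

/-- The inclusion of the finite combinations of number states into Fock space. -/
def toFock {m : ℕ} : FiniteFock m →ₗ[ℂ] FockSpace m :=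
  Finsupp.linearCombination ℂ numberKet

/-- The annihilation operator: `a_j |k⟩ = √k_j |k - e_j⟩`. -/
def annihilation {m : ℕ} (j : Fin m) : Module.End ℂ (FiniteFock m) :=
  Finsupp.linearCombination ℂ fun k : Fin m → ℕ =>
    Finsupp.single (k - Pi.single j 1) (Real.sqrt (k j : ℝ) : ℂ)

/-- The creation operator: `a_j† |k⟩ = √(k_j + 1) |k + e_j⟩`. -/
def creation {m : ℕ} (j : Fin m) : Module.End ℂ (FiniteFock m) :=
  Finsupp.linearCombination ℂ fun k : Fin m → ℕ =>
    Finsupp.single (k + Pi.single j 1) (Real.sqrt ((k j : ℝ) + 1) : ℂ)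

/-- The quadratures `Q_j = √(ħ/2) (a_j + a_j†)` and `P_j = -i √(ħ/2) (a_j - a_j†)`. -/
def quadrature {m : ℕ} (ħ : ℝ) : Ix m → Module.End ℂ (FiniteFock m)
  | Sum.inl j => (Real.sqrt (ħ / 2) : ℂ) • (annihilation j + creation j)
  | Sum.inr j => (-Complex.I * (Real.sqrt (ħ / 2) : ℂ)) • (annihilation j - creation j)

/-- The expectation value `Tr[ρ R]` of a polynomial `R` in the quadratures exists, as an absolutely
convergent sum over the number basis, and is equal to `x`. -/
def HasExpectation {m : ℕ} (ρ : TraceClass m) (R : Module.End ℂ (FiniteFock m)) (x : ℝ) : Prop :=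
  HasSum (fun k : Fin m → ℕ =>
    (inner ℂ (numberKet k) (ρ.1 (toFock (R (Finsupp.single k 1)))) : ℂ)) (x : ℂ)

/-- `μ` is the vector of means of `ρ`. -/
def HasMean {m : ℕ} (ħ : ℝ) (ρ : TraceClass m) (μ : Ix m → ℝ) : Prop :=
  ∀ i, HasExpectation ρ (quadrature ħ i) (μ i)

/-- `S` is the covariance matrix of `ρ` about the means `μ`:
`S i j = Tr[ρ {R_i - μ_i, R_j - μ_j}] / 2`. -/
def HasCovariance {m : ℕ} (ħ : ℝ) (ρ : TraceClass m) (μ : Ix m → ℝ)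
    (S : Matrix (Ix m) (Ix m) ℝ) : Prop :=
  ∀ i j, HasExpectation ρ
    ((1 / 2 : ℂ) •
      ((quadrature ħ i - (μ i : ℂ) • 1) * (quadrature ħ j - (μ j : ℂ) • 1) +
        (quadrature ħ j - (μ j : ℂ) • 1) * (quadrature ħ i - (μ i : ℂ) • 1))) (S i j)

/-- `(X, Y, d)` is the phase-space form of the channel `Φ`: on Gaussian states, `Φ` transforms means
and covariance matrices by `μ ↦ X μ + d` and `S ↦ X S Xᵀ + Y`. -/
def QuantumChannel.HasPhaseSpaceForm {m : ℕ} (ħ : ℝ) (Φ : QuantumChannel m)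
    (X Y : Matrix (Ix m) (Ix m) ℝ) (d : Ix m → ℝ) : Prop :=
  ∀ (ρ : TraceClass m) (μ : Ix m → ℝ) (S : Matrix (Ix m) (Ix m) ℝ),
    IsGaussianState ρ → HasMean ħ ρ μ → HasCovariance ħ ρ μ S →
      HasMean ħ (Φ.toLinearMap ρ) (X *ᵥ μ + d) ∧
      HasCovariance ħ (Φ.toLinearMap ρ) (X *ᵥ μ + d) (X * S * Xᵀ + Y)

/-! ### The matrices `X` and `W` -/

/-- The swap matrix `X = [0 1; 1 0]`. -/
def swapX (m : ℕ) : Matrix (Ix m) (Ix m) ℂ := Matrix.fromBlocks 0 1 1 0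

/-- The unitary `W = [1 i; 1 -i] / √2` from the `q/p` basis to the amplitude basis. -/
def W (m : ℕ) : Matrix (Ix m) (Ix m) ℂ :=
  (1 / (Real.sqrt 2 : ℂ)) • Matrix.fromBlocks 1 (Complex.I • 1) 1 (-Complex.I • 1)

end

end Bargmann

namespace Bargmann

noncomputable section

/-! ### Everywhere convergent power series in several variables -/

/-! It suffices to test `Φ` on coherent states. Setting `(w', z') = (α*, α)` in `F_Φ` gives the
Bargmann function of `Φ(|α⟩⟨α|)` up to a constant: a Gaussian in `(w, z)` with quadratic part `Aout`
and linear part `b_out + Γᵀ (α*, α)`, where `b_out` is the `(w, z)` part of `b`. Everything then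
follows from the moments of a positive operator of trace one with Gaussian Bargmann function `F`.

Such an `F` satisfies `∂F = (A ζ + b) F`. The Taylor coefficients of `F` are the matrix elements
divided by square roots of factorials, so this equation is an identity between forms: a derivative
inserts a creation operator and a variable inserts an annihilation operator, on the ket for `w` and
on the bra for `z` (`isGaussianForm_form`). Cyclicity of the trace turns the derivative in a
variable into multiplication by the conjugate variable, which is the origin of the swap `X`
(`hasTrace_derivVar_iff`). Taking traces gives `(X - A) t = b` for the first moments `t`, and `(M -
t tᵀ)(X - A) = 1` for the antinormally ordered second moments `M`. Hence `X - A` is invertible, and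
`(X - A)⁻¹ - X/2` is the symmetrized covariance of `(a, a†)`. Since `R = √ħ W† (a, a†)`, conjugation
by `W` gives the quadratures.

The sums defining the moments must converge. For the output this comes from the phase-space form
itself: finite variances of `Q_j` and `P_j` bound the mean photon number, and Cauchy–Schwarz then
controls all first and second moments. Comparing means for all coherent inputs yields `XΦ`, and the
covariance of one output yields `YΦ`; finally `1 - X Aout = X (X - Aout)`. -/

theorem hasSum_of_eq {α : Type*} {f g : α → ℂ} {x y : ℂ} (h : HasSum f x) (hfg : ∀ a, g a = f a)
    (hxy : y = x) : HasSum g y :=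
  hxy ▸ (funext hfg : g = f) ▸ h

theorem sub_single_add_single {ι : Type*} [DecidableEq ι] {n : ι → ℕ} {i : ι} (hi : n i ≠ 0) :
    n - Pi.single i 1 + Pi.single i 1 = n := by
  funext j
  by_cases hj : j = i
  · subst hj
    simp
    omega
  · simp [hj]

/-- The shift by `Pi.single i 1` misses exactly the indices with `n i = 0`. This reindexing serves
both power series and cyclicity of the trace. -/
theorem hasSum_add_single_iff {ι : Type*} [DecidableEq ι] {E : Type*} [AddCommMonoid E]
    [TopologicalSpace E] (i : ι) {f : (ι → ℕ) → E} (hf : ∀ n, n i = 0 → f n = 0) {x : E} :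
    HasSum (fun n : ι → ℕ => f (n + Pi.single i 1)) x ↔ HasSum f x := by
  refine Function.Injective.hasSum_iff (g := fun n : ι → ℕ => n + Pi.single i 1)
    (add_left_injective _) ?_
  intro n hn
  refine hf n ?_
  by_contra h
  exact hn ⟨n - Pi.single i 1, sub_single_add_single h⟩

theorem prod_update_pow {ι : Type*} [Fintype ι] [DecidableEq ι] (ζ : ι → ℂ) (i : ι) (y : ℂ)
    (n : ι → ℕ) :
    ∏ j, Function.update ζ i y j ^ n j = y ^ n i * ∏ j ∈ Finset.univ.erase i, ζ j ^ n j := by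
  rw [← Finset.mul_prod_erase _ _ (Finset.mem_univ i), Function.update_self]
  congr 1
  refine Finset.prod_congr rfl fun j hj => ?_
  rw [Function.update_of_ne (Finset.ne_of_mem_erase hj)]

theorem prod_pow_add_single {ι : Type*} [Fintype ι] [DecidableEq ι] (ζ : ι → ℂ) (i : ι)
    (n : ι → ℕ) : ∏ j, ζ j ^ (n + Pi.single i 1 : ι → ℕ) j = ζ i * ∏ j, ζ j ^ n j := by
  simp only [Pi.add_apply, pow_add, Finset.prod_mul_distrib]
  rw [mul_comm]
  congr 1
  rw [Finset.prod_eq_single i] <;> simp +contextual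

/-- Dominates a differentiated power series at radius `r` by the original one at radius `r + 1`. -/
theorem natCast_mul_pow_le (n : ℕ) {r : ℝ} (hr : 0 ≤ r) : n * r ^ (n - 1) ≤ (r + 1) ^ n := by
  cases n with
  | zero => simp
  | succ n =>
    induction n with
    | zero => simpa using hr
    | succ n ih =>
      have h : r ^ (n + 1) ≤ (r + 1) ^ (n + 1) := by gcongr; linarith
      simp only [Nat.add_sub_cancel] at ih ⊢
      push_cast at ih ⊢
      have : (n + 1 + 1 : ℝ) * r ^ (n + 1) = r * ((n + 1) * r ^ n) + r ^ (n + 1) := by ring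
      rw [this, pow_succ (r + 1) (n + 1)]
      nlinarith [mul_le_mul_of_nonneg_left ih hr]

/-- Termwise differentiation in one variable with the others frozen. Convergence everywhere makes
the absolute series at `r + 1` a uniform bound on the ball of radius `r`. -/
theorem hasDerivAt_powerSeries {ι : Type*} [Fintype ι] [DecidableEq ι] {f : (ι → ℕ) → ℂ}
    {F : (ι → ℂ) → ℂ} (hf : ∀ ζ : ι → ℂ, HasSum (fun n => f n * ∏ i, ζ i ^ n i) (F ζ)) (i : ι)
    (ζ : ι → ℂ) {F' : ℂ} (hF : HasDerivAt (fun y => F (Function.update ζ i y)) F' (ζ i)) :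
    HasSum (fun n : ι → ℕ => (n i + 1 : ℂ) * f (n + Pi.single i 1) * ∏ j, ζ j ^ n j) F' := by
  set r : ℝ := ‖ζ i‖ + 1 with hr
  have hr0 : 0 ≤ r := by positivity
  let c : (ι → ℕ) → ℂ := fun n => ∏ j ∈ Finset.univ.erase i, ζ j ^ n j
  let g' : (ι → ℕ) → ℂ → ℂ := fun n y => f n * ((n i) * y ^ (n i - 1) * c n)
  have hsum := fun y => hf (Function.update ζ i y)
  simp only [prod_update_pow] at hsum
  have hu := (hsum ((r + 1 : ℝ) : ℂ)).summable.norm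
  have hb : ∀ n y, y ∈ Metric.ball (0 : ℂ) r →
      ‖g' n y‖ ≤ ‖f n * ((((r + 1 : ℝ) : ℂ)) ^ n i * c n)‖ := by
    intro n y hy
    have hy' : ‖y‖ ≤ r := by simpa using (mem_ball_zero_iff.1 hy).le
    simp only [g', norm_mul, norm_pow, Complex.norm_natCast, Complex.norm_real, Real.norm_eq_abs,
      abs_of_nonneg (by positivity : 0 ≤ r + 1)]
    gcongr
    refine le_trans ?_ (natCast_mul_pow_le (n i) hr0)
    gcongr
  have hmem : ζ i ∈ Metric.ball (0 : ℂ) r := by simp [hr]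
  have hder := hasDerivAt_tsum_of_isPreconnected hu Metric.isOpen_ball
    (convex_ball (0 : ℂ) r).isPreconnected (g := fun n y => f n * (y ^ n i * c n)) (g' := g')
    (fun n y _ => (((hasDerivAt_pow (n i) y).mul_const (c n)).const_mul (f n))) hb hmem
    (hsum _).summable hmem
  have hFeq : (fun y => ∑' n, f n * (y ^ n i * c n)) = fun y => F (Function.update ζ i y) :=
    funext fun y => (hsum y).tsum_eq
  rw [hFeq] at hder
  have hs : Summable fun n => g' n (ζ i) :=
    Summable.of_norm_bounded hu fun n => hb n _ hmem
  have hs' : HasSum (fun n => g' n (ζ i)) F' := by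
    rw [hF.unique hder]
    exact hs.hasSum
  have h0 : ∀ n : ι → ℕ, n i = 0 → g' n (ζ i) = 0 := by
    intro n hn
    simp [g', hn]
  convert (hasSum_add_single_iff i h0).2 hs' using 1
  funext n
  rw [← Finset.mul_prod_erase _ _ (Finset.mem_univ i)]
  have hc : c (n + Pi.single i 1) = ∏ j ∈ Finset.univ.erase i, ζ j ^ n j :=
    Finset.prod_congr rfl fun j hj => by simp [Finset.ne_of_mem_erase hj]
  simp only [g', hc, Pi.add_apply, Pi.single_eq_same, Nat.add_sub_cancel]
  push_cast
  ring

/-- Induction on the total degree: evaluation at the origin isolates the constant term, and a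
partial derivative lowers the degree of any other coefficient. -/
theorem powerSeries_eq_zero {ι : Type*} [Fintype ι] [DecidableEq ι] {f : (ι → ℕ) → ℂ}
    (hf : ∀ ζ : ι → ℂ, HasSum (fun n => f n * ∏ i, ζ i ^ n i) 0) (n : ι → ℕ) : f n = 0 := by
  induction h : ∑ i, n i generalizing f n with
  | zero =>
    have hn : n = 0 := funext fun i => by
      simpa using Finset.sum_eq_zero_iff.1 h i (Finset.mem_univ i)
    subst hn
    have h1 := (hasSum_single (f := fun n : ι → ℕ => f n * ∏ i, (0 : ι → ℂ) i ^ n i) 0 ?_).unique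
      (hf 0)
    · simpa using h1
    · intro n hn
      obtain ⟨i, hi⟩ := Function.ne_iff.1 hn
      exact mul_eq_zero_of_right _ (Finset.prod_eq_zero (Finset.mem_univ i) (zero_pow hi))
  | succ N ih =>
    obtain ⟨i, hi⟩ : ∃ i, n i ≠ 0 := by
      by_contra! h0
      simp [h0] at h
    have h1 := ih (f := fun n : ι → ℕ => (n i + 1 : ℂ) * f (n + Pi.single i 1))
      (fun ζ => hasDerivAt_powerSeries hf i ζ (hasDerivAt_const _ _)) (n - Pi.single i 1) ?_
    · have h2 : n - Pi.single i 1 + Pi.single i 1 = n := sub_single_add_single hi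
      rw [h2] at h1
      exact (mul_eq_zero.1 h1).resolve_left (Nat.cast_add_one_ne_zero _)
    · rw [← sub_single_add_single hi] at h
      simpa [Finset.sum_add_distrib] using h

theorem powerSeries_injective {ι : Type*} [Fintype ι] [DecidableEq ι] {f g : (ι → ℕ) → ℂ}
    {F : (ι → ℂ) → ℂ} (hf : ∀ ζ : ι → ℂ, HasSum (fun n => f n * ∏ i, ζ i ^ n i) (F ζ))
    (hg : ∀ ζ : ι → ℂ, HasSum (fun n => g n * ∏ i, ζ i ^ n i) (F ζ)) : f = g := by
  funext n
  refine sub_eq_zero.1 (powerSeries_eq_zero (f := fun n => f n - g n) (fun ζ => ?_) n)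
  simpa only [sub_mul, sub_self] using (hf ζ).sub (hg ζ)

theorem hasDerivAt_gaussianFun {ι : Type} [Fintype ι] [DecidableEq ι] {A : Matrix ι ι ℂ}
    (hA : A.IsSymm) (b : ι → ℂ) (c : ℂ) (ζ : ι → ℂ) (i : ι) :
    HasDerivAt (fun y => gaussianFun A b c (Function.update ζ i y))
      ((∑ j, A i j * ζ j + b i) * gaussianFun A b c ζ) (ζ i) := by
  have hu : ∀ j, HasDerivAt (fun y => Function.update ζ i y j) ((Pi.single i (1 : ℂ) : ι → ℂ) j)
      (ζ i) := fun j => hasDerivAt_pi.1 (hasDerivAt_update ζ i (ζ i)) j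
  have hlin : HasDerivAt (fun y => Function.update ζ i y ⬝ᵥ b) (b i) (ζ i) := by
    have := HasDerivAt.fun_sum (u := Finset.univ) fun j _ => (hu j).mul_const (b j)
    simpa [dotProduct, Pi.single_apply] using this
  have hmv : ∀ j, HasDerivAt (fun y => (A *ᵥ Function.update ζ i y) j) (A j i) (ζ i) := by
    intro j
    have := HasDerivAt.fun_sum (u := Finset.univ) fun l _ => (hu l).const_mul (A j l)
    simpa [Matrix.mulVec, dotProduct, Pi.single_apply] using this
  -- The two halves of the product rule agree by symmetry of `A`; the resulting factor 2 cancels the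
  -- 1/2 in `gaussianFun`.
  have hquad : HasDerivAt (fun y => Function.update ζ i y ⬝ᵥ (A *ᵥ Function.update ζ i y))
      (2 * ∑ j, A i j * ζ j) (ζ i) := by
    have := HasDerivAt.fun_sum (u := Finset.univ) fun j _ => (hu j).fun_mul (hmv j)
    refine HasDerivAt.congr_deriv (f := fun y => ∑ j, _) this ?_
    simp only [Function.update_eq_self, Finset.sum_add_distrib, Pi.single_apply, ite_mul, one_mul,
      zero_mul, Finset.sum_ite_eq', Finset.mem_univ, if_true, two_mul]
    congr 1
    refine Finset.sum_congr rfl fun j _ => ?_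
    rw [hA.apply, mul_comm]
  refine ((((hquad.const_mul (1 / 2 : ℂ)).fun_add hlin).cexp).const_mul c).congr_deriv ?_
  simp only [gaussianFun, Function.update_eq_self]
  ring

/-- Compares coefficients in `∂ᵢF = ((A ζ)ᵢ + bᵢ) F`. The case `n j = 0` is separate because
truncated subtraction would give back `f n` instead of 0. -/
theorem gaussianFun_coeff {ι : Type} [Fintype ι] [DecidableEq ι] {A : Matrix ι ι ℂ}
    (hA : A.IsSymm) {b : ι → ℂ} {c : ℂ} {f : (ι → ℕ) → ℂ}
    (hf : ∀ ζ : ι → ℂ, HasSum (fun n => f n * ∏ i, ζ i ^ n i) (gaussianFun A b c ζ))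
    (i : ι) (n : ι → ℕ) :
    (n i + 1 : ℂ) * f (n + Pi.single i 1) =
      ∑ j, A i j * (if n j = 0 then 0 else f (n - Pi.single j 1)) + b i * f n := by
  have key : (fun n : ι → ℕ => (n i + 1 : ℂ) * f (n + Pi.single i 1)) = fun n =>
      ∑ j, A i j * (if n j = 0 then 0 else f (n - Pi.single j 1)) + b i * f n := by
    refine powerSeries_injective (F := fun ζ => (∑ j, A i j * ζ j + b i) * gaussianFun A b c ζ)
      (fun ζ => hasDerivAt_powerSeries hf i ζ (hasDerivAt_gaussianFun hA b c ζ i)) ?_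
    intro ζ
    have h1 : ∀ j, HasSum (fun n : ι → ℕ => (if n j = 0 then 0 else f (n - Pi.single j 1)) *
        ∏ i, ζ i ^ n i) (ζ j * gaussianFun A b c ζ) := by
      intro j
      refine (hasSum_add_single_iff j (by simp +contextual)).1 ?_
      simp only [prod_pow_add_single]
      refine hasSum_of_eq ((hf ζ).mul_left (ζ j)) (fun n => ?_) rfl
      simp only [Pi.add_apply, Pi.single_eq_same, Nat.add_eq_zero_iff, one_ne_zero, and_false,
        if_false, add_tsub_cancel_right]
      ring
    refine hasSum_of_eq ((hasSum_sum (s := Finset.univ) fun j _ => (h1 j).mul_left (A i j)).add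
      ((hf ζ).mul_left (b i))) (fun n => ?_) ?_ <;>
    · rw [add_mul, Finset.sum_mul]
      simp only [mul_assoc]
  exact congrFun key n

/-! ### Ladder operators on the number basis -/

theorem annihilation_single {m : ℕ} (j : Fin m) (k : Fin m → ℕ) :
    annihilation j (Finsupp.single k 1) =
      (Real.sqrt (k j : ℝ) : ℂ) • Finsupp.single (k - Pi.single j 1) 1 := by
  simp [annihilation, Finsupp.linearCombination_single]

theorem creation_single {m : ℕ} (j : Fin m) (k : Fin m → ℕ) :
    creation j (Finsupp.single k 1) =
      (Real.sqrt ((k j : ℝ) + 1) : ℂ) • Finsupp.single (k + Pi.single j 1) 1 := by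
  simp [creation, Finsupp.linearCombination_single]

theorem annihilation_creation_single {m : ℕ} (j : Fin m) (k : Fin m → ℕ) :
    annihilation j (creation j (Finsupp.single k 1)) = ((k j : ℂ) + 1) • Finsupp.single k 1 := by
  rw [creation_single, map_smul, annihilation_single, smul_smul, ← Complex.ofReal_mul]
  simp only [Pi.add_apply, Pi.single_eq_same, add_tsub_cancel_right, Nat.cast_add, Nat.cast_one]
  rw [Real.mul_self_sqrt (by positivity)]
  push_cast
  rfl

theorem creation_annihilation_single {m : ℕ} (j : Fin m) (k : Fin m → ℕ) :
    creation j (annihilation j (Finsupp.single k 1)) = (k j : ℂ) • Finsupp.single k 1 := by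
  rw [annihilation_single, map_smul, creation_single, smul_smul]
  by_cases hk : k j = 0
  · simp [hk]
  · have h : ((k - Pi.single j 1 : Fin m → ℕ) j : ℝ) + 1 = k j := by
      have := congrFun (sub_single_add_single hk) j
      rw [← this]
      simp
    rw [h, sub_single_add_single hk, ← Complex.ofReal_mul, Real.mul_self_sqrt (by positivity)]
    norm_cast

theorem annihilation_creation {m : ℕ} (i j : Fin m) (u : FiniteFock m) :
    annihilation i (creation j u) =
      creation j (annihilation i u) + (if i = j then (1 : ℂ) else 0) • u := by
  suffices h : annihilation i ∘ₗ creation j =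
      creation j ∘ₗ annihilation i + (if i = j then (1 : ℂ) else 0) • LinearMap.id from
    congrArg (fun f : FiniteFock m →ₗ[ℂ] FiniteFock m => f u) h
  refine Finsupp.lhom_ext' fun k => LinearMap.ext_ring ?_
  simp only [LinearMap.comp_apply, Finsupp.lsingle_apply, LinearMap.add_apply,
    LinearMap.smul_apply, LinearMap.id_apply]
  by_cases hij : i = j
  · subst hij
    rw [annihilation_creation_single, creation_annihilation_single, if_pos rfl, add_smul]
  · rw [if_neg hij, zero_smul, add_zero, annihilation_single, creation_single, map_smul, map_smul,
      annihilation_single, creation_single, smul_smul, smul_smul]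
    by_cases hk : k i = 0
    · simp [hk, hij]
    · have h : (k + Pi.single j 1 - Pi.single i 1 : Fin m → ℕ) =
          k - Pi.single i 1 + Pi.single j 1 := by
        funext l
        by_cases hl : l = i
        · subst hl
          simp [hij]
        · simp [hl]
      simp [h, hij, Ne.symm hij, mul_comm]

theorem annihilation_comm {m : ℕ} (i j : Fin m) (u : FiniteFock m) :
    annihilation i (annihilation j u) = annihilation j (annihilation i u) := by
  suffices h : annihilation i ∘ₗ annihilation j = annihilation j ∘ₗ annihilation i from
    congrArg (fun f : FiniteFock m →ₗ[ℂ] FiniteFock m => f u) h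
  refine Finsupp.lhom_ext' fun k => LinearMap.ext_ring ?_
  simp only [LinearMap.comp_apply, Finsupp.lsingle_apply]
  by_cases hij : i = j
  · rw [hij]
  · rw [annihilation_single, annihilation_single, map_smul, map_smul, annihilation_single,
      annihilation_single, smul_smul, smul_smul, tsub_right_comm]
    simp [hij, Ne.symm hij, mul_comm]

/-! ### Sesquilinear forms on the finite combinations of number states -/

/-- Sesquilinear forms `⟨u| T |v⟩` on the finite combinations of number states. -/
abbrev Form (m : ℕ) : Type := FiniteFock m →ₗ⋆[ℂ] FiniteFock m →ₗ[ℂ] ℂ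

/-- Multiplication of the Bargmann function of a form by a variable. -/
def mulVar {m : ℕ} : Ix m → Form m → Form m
  | Sum.inl j, K => K.compl₂ (annihilation j)
  | Sum.inr j, K => K.comp (annihilation j)

/-- Differentiation of the Bargmann function of a form in a variable. -/
def derivVar {m : ℕ} : Ix m → Form m → Form m
  | Sum.inl j, K => K.compl₂ (creation j)
  | Sum.inr j, K => K.comp (creation j)

@[simp] theorem mulVar_inl_apply {m : ℕ} (j : Fin m) (K : Form m) (u v : FiniteFock m) :
    mulVar (Sum.inl j) K u v = K u (annihilation j v) := rfl

@[simp] theorem mulVar_inr_apply {m : ℕ} (j : Fin m) (K : Form m) (u v : FiniteFock m) :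
    mulVar (Sum.inr j) K u v = K (annihilation j u) v := rfl

@[simp] theorem derivVar_inl_apply {m : ℕ} (j : Fin m) (K : Form m) (u v : FiniteFock m) :
    derivVar (Sum.inl j) K u v = K u (creation j v) := rfl

@[simp] theorem derivVar_inr_apply {m : ℕ} (j : Fin m) (K : Form m) (u v : FiniteFock m) :
    derivVar (Sum.inr j) K u v = K (creation j u) v := rfl

theorem mulVar_comm {m : ℕ} (p q : Ix m) (K : Form m) :
    mulVar p (mulVar q K) = mulVar q (mulVar p K) := by
  refine LinearMap.ext₂ fun u v => ?_
  rcases p with i | i <;> rcases q with j | j <;> simp [annihilation_comm i j]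

/-- The Leibniz rule `∂_q (ζ_p F) = ζ_p ∂_q F + δ_pq F`, here a form of the canonical commutation
relations. -/
theorem mulVar_derivVar {m : ℕ} (p q : Ix m) (K : Form m) :
    mulVar p (derivVar q K) = derivVar q (mulVar p K) - (if p = q then (1 : ℂ) else 0) • K := by
  refine LinearMap.ext₂ fun u v => ?_
  rcases p with i | i <;> rcases q with j | j <;>
    rcases eq_or_ne i j with rfl | h <;> simp [annihilation_creation, *]

theorem mulVar_add {m : ℕ} (p : Ix m) (K L : Form m) :
    mulVar p (K + L) = mulVar p K + mulVar p L := by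
  refine LinearMap.ext₂ fun u v => ?_
  rcases p with i | i <;> simp

theorem mulVar_smul {m : ℕ} (p : Ix m) (c : ℂ) (K : Form m) :
    mulVar p (c • K) = c • mulVar p K := by
  refine LinearMap.ext₂ fun u v => ?_
  rcases p with i | i <;> simp

theorem mulVar_sum {m : ℕ} {ι : Type*} (s : Finset ι) (p : Ix m) (K : ι → Form m) :
    mulVar p (∑ i ∈ s, K i) = ∑ i ∈ s, mulVar p (K i) := by
  refine LinearMap.ext₂ fun u v => ?_
  rcases p with i | i <;> simp [LinearMap.sum_apply]

/-- The trace of a form over the number basis exists and is equal to `x`. -/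
def HasTrace {m : ℕ} (K : Form m) (x : ℂ) : Prop :=
  HasSum (fun k : Fin m → ℕ => K (Finsupp.single k 1) (Finsupp.single k 1)) x

theorem HasTrace.add {m : ℕ} {K L : Form m} {x y : ℂ} (hK : HasTrace K x) (hL : HasTrace L y) :
    HasTrace (K + L) (x + y) := HasSum.add hK hL

theorem HasTrace.sub {m : ℕ} {K L : Form m} {x y : ℂ} (hK : HasTrace K x) (hL : HasTrace L y) :
    HasTrace (K - L) (x - y) := HasSum.sub hK hL

theorem HasTrace.smul {m : ℕ} {K : Form m} {x : ℂ} (c : ℂ) (hK : HasTrace K x) :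
    HasTrace (c • K) (c * x) := HasSum.mul_left c hK

theorem HasTrace.sum {m : ℕ} {ι : Type*} {s : Finset ι} {K : ι → Form m} {x : ι → ℂ}
    (h : ∀ i, HasTrace (K i) (x i)) : HasTrace (∑ i ∈ s, K i) (∑ i ∈ s, x i) := by
  refine hasSum_of_eq (hasSum_sum fun i _ => h i) (fun k => ?_) rfl
  simp [LinearMap.sum_apply]

theorem HasTrace.unique {m : ℕ} {K : Form m} {x y : ℂ} (hx : HasTrace K x) (hy : HasTrace K y) :
    x = y := HasSum.unique hx hy

/-- Cyclicity of the trace for one ladder operator. Both diagonal series have terms `√(k_j + 1) ⟨k +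
e_j| K |k⟩` after an index shift, so neither side needs a summability assumption. -/
theorem hasTrace_comp_left_creation_iff {m : ℕ} (K : Form m) (j : Fin m) (x : ℂ) :
    HasTrace (K.comp (creation j)) x ↔ HasTrace (K.compl₂ (annihilation j)) x := by
  have h := hasSum_add_single_iff j (x := x)
    (f := fun k : Fin m → ℕ => K (Finsupp.single k 1) (annihilation j (Finsupp.single k 1))) (by
      intro k hk
      simp [annihilation_single, hk])
  refine Iff.trans ?_ h
  unfold HasTrace
  refine Eq.to_iff (congrArg (fun f => HasSum f x) (funext fun k => ?_))
  simp [annihilation_single, creation_single, -Finsupp.smul_single, -Complex.coe_smul]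

theorem hasTrace_comp_left_annihilation_iff {m : ℕ} (K : Form m) (j : Fin m) (x : ℂ) :
    HasTrace (K.comp (annihilation j)) x ↔ HasTrace (K.compl₂ (creation j)) x := by
  have h := hasSum_add_single_iff j (x := x)
    (f := fun k : Fin m → ℕ => K (annihilation j (Finsupp.single k 1)) (Finsupp.single k 1)) (by
      intro k hk
      simp [annihilation_single, hk])
  refine h.symm.trans ?_
  unfold HasTrace
  refine Eq.to_iff (congrArg (fun f => HasSum f x) (funext fun k => ?_))
  simp [annihilation_single, creation_single, -Finsupp.smul_single, -Complex.coe_smul]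

theorem hasTrace_derivVar_iff {m : ℕ} (p : Ix m) (K : Form m) (x : ℂ) :
    HasTrace (derivVar p K) x ↔ HasTrace (mulVar p.swap K) x := by
  rcases p with j | j
  · exact (hasTrace_comp_left_annihilation_iff K j x).symm
  · exact hasTrace_comp_left_creation_iff K j x

/-! ### Moments of Gaussian forms -/

theorem swapX_mulVec {m : ℕ} (t : Ix m → ℂ) (p : Ix m) : (swapX m *ᵥ t) p = t p.swap := by
  rcases p with j | j <;>
    simp [swapX, Matrix.mulVec, dotProduct, Fintype.sum_sum_type, Matrix.one_apply]

theorem mul_swapX_apply {m : ℕ} (M : Matrix (Ix m) (Ix m) ℂ) (p q : Ix m) :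
    (M * swapX m) p q = M p q.swap := by
  rcases q with j | j <;>
    simp [swapX, Matrix.mul_apply, Fintype.sum_sum_type, Matrix.one_apply]

/-- A form whose Bargmann function `F` satisfies `∂F = (A ζ + b) F`. -/
def IsGaussianForm {m : ℕ} (B : Form m) (A : Matrix (Ix m) (Ix m) ℂ) (b : Ix m → ℂ) : Prop :=
  ∀ p, derivVar p B = ∑ q, A p q • mulVar q B + b p • B

theorem IsGaussianForm.first_moments {m : ℕ} {B : Form m} {A : Matrix (Ix m) (Ix m) ℂ}
    {b t : Ix m → ℂ} (hB : IsGaussianForm B A b) (h1 : HasTrace B 1)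
    (ht : ∀ p, HasTrace (mulVar p B) (t p)) : (swapX m - A) *ᵥ t = b := by
  funext p
  have h2 : HasTrace (derivVar p B) (∑ q, A p q * t q + b p * 1) := by
    rw [hB p]
    exact (HasTrace.sum fun q => (ht q).smul _).add (h1.smul _)
  have h3 := h2.unique ((hasTrace_derivVar_iff p B _).2 (ht p.swap))
  rw [Matrix.sub_mulVec, Pi.sub_apply, swapX_mulVec, ← h3]
  simp [Matrix.mulVec, dotProduct]

/-- The trace of `ζ_p ∂_q B` is computed twice: by the Gaussian equation, and by commuting then
using cyclicity. Invertibility of `swapX m - A` is a consequence, not an assumption. -/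
theorem IsGaussianForm.second_moments {m : ℕ} {B : Form m} {A M : Matrix (Ix m) (Ix m) ℂ}
    {b t : Ix m → ℂ} (hA : A.IsSymm) (hB : IsGaussianForm B A b) (h1 : HasTrace B 1)
    (ht : ∀ p, HasTrace (mulVar p B) (t p))
    (hM : ∀ p q, HasTrace (mulVar p (mulVar q B)) (M p q)) :
    (M - Matrix.vecMulVec t t) * (swapX m - A) = 1 := by
  have hb := hB.first_moments h1 ht
  have hX : (swapX m)ᵀ = swapX m := by simp [swapX, Matrix.fromBlocks_transpose]
  have key : M * swapX m - 1 = M * A + Matrix.vecMulVec t b := by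
    ext p q
    have h2 : HasTrace (mulVar p (derivVar q B)) (∑ r, A q r * M p r + b q * t p) := by
      rw [hB q, mulVar_add, mulVar_sum]
      simp only [mulVar_smul]
      exact (HasTrace.sum fun r => (hM p r).smul _).add ((ht p).smul _)
    have h3 : HasTrace (mulVar p (derivVar q B)) (M p q.swap - (if p = q then 1 else 0) * 1) := by
      rw [mulVar_derivVar]
      refine HasTrace.sub ?_ (h1.smul _)
      rw [hasTrace_derivVar_iff, mulVar_comm]
      exact hM p q.swap
    have h4 := h3.unique h2
    rw [Matrix.sub_apply, mul_swapX_apply, Matrix.one_apply, Matrix.add_apply, Matrix.mul_apply,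
      Matrix.vecMulVec_apply]
    rw [mul_one] at h4
    rw [h4, mul_comm (b q)]
    congr 1
    refine Finset.sum_congr rfl fun r _ => ?_
    rw [hA.apply, mul_comm]
  -- The first-moment equation, transposed, turns `t tᵀ (X - A)` into `t bᵀ`, which cancels the
  -- linear term of `key`.
  rw [Matrix.sub_mul, Matrix.mul_sub, Matrix.vecMulVec_mul, ← Matrix.mulVec_transpose,
    Matrix.transpose_sub, hX, hA.eq, hb]
  rw [sub_eq_iff_eq_add] at key
  rw [key]
  abel

/-! ### Positive forms and the existence of their moments -/

/-- Positive semidefinite Hermitian forms. -/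
structure IsPosForm {m : ℕ} (B : Form m) : Prop where
  conj_symm : ∀ u v, (starRingEnd ℂ) (B v u) = B u v
  nonneg : ∀ u, 0 ≤ (B u u).re

/-- Positivity on `u - c v`, with the phase `c` chosen so that `c B(u, v) = ‖B(u, v)‖`. -/
theorem IsPosForm.norm_le {m : ℕ} {B : Form m} (hB : IsPosForm B) (u v : FiniteFock m) :
    ‖B u v‖ ≤ (B u u).re + (B v v).re := by
  obtain ⟨c, hc, h⟩ := Complex.exists_norm_eq_mul_self (B u v)
  have h1 := hB.nonneg (u - c • v)
  have hcc : (starRingEnd ℂ) c * c = 1 := by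
    rw [mul_comm, Complex.mul_conj, Complex.normSq_eq_norm_sq, hc]
    simp
  have h2 : B (u - c • v) (u - c • v) =
      B u u + B v v - ((‖B u v‖ : ℂ) + (starRingEnd ℂ) (‖B u v‖ : ℂ)) := by
    rw [h, map_mul, hB.conj_symm]
    simp only [map_sub, LinearMap.sub_apply, LinearMap.map_smulₛₗ, LinearMap.smul_apply,
      smul_eq_mul, RingHom.id_apply]
    linear_combination (B v v) * hcc
  rw [h2] at h1
  simp only [Complex.conj_ofReal, Complex.sub_re, Complex.add_re, Complex.ofReal_re] at h1
  have := hB.nonneg u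
  have := hB.nonneg v
  linarith [norm_nonneg (B u v)]

theorem IsPosForm.exists_hasTrace {m : ℕ} {B : Form m} (hB : IsPosForm B)
    {K : Form m} {R S : Module.End ℂ (FiniteFock m)}
    (hK : ∀ k, K (Finsupp.single k 1) (Finsupp.single k 1) =
      B (R (Finsupp.single k 1)) (S (Finsupp.single k 1)))
    (hR : Summable fun k => B (R (Finsupp.single k 1)) (R (Finsupp.single k 1)))
    (hS : Summable fun k => B (S (Finsupp.single k 1)) (S (Finsupp.single k 1))) :
    ∃ x, HasTrace K x := by
  refine ⟨_, (Summable.of_norm_bounded ((Complex.reCLM.summable hR).add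
    (Complex.reCLM.summable hS)) fun k => ?_).hasSum⟩
  rw [hK]
  exact hB.norm_le _ _

/-- By cyclicity the series is the trace with `a†a` inserted, that is, the mean photon number; for
annihilation it is `a a† = N + 1`. -/
theorem summable_creation {m : ℕ} {B : Form m} (j : Fin m)
    (hN : Summable fun k : Fin m → ℕ => (k j : ℂ) * B (Finsupp.single k 1) (Finsupp.single k 1)) :
    Summable fun k => B (creation j (Finsupp.single k 1)) (creation j (Finsupp.single k 1)) := by
  have h : HasTrace ((B.compl₂ (creation j)).compl₂ (annihilation j)) _ :=
    hasSum_of_eq hN.hasSum (fun k => by simp [creation_annihilation_single, -Finsupp.smul_single])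
      rfl
  exact ((hasTrace_comp_left_creation_iff _ j _).2 h).summable

theorem summable_annihilation {m : ℕ} {B : Form m} (j : Fin m)
    (h1 : Summable fun k : Fin m → ℕ => B (Finsupp.single k 1) (Finsupp.single k 1))
    (hN : Summable fun k : Fin m → ℕ => (k j : ℂ) * B (Finsupp.single k 1) (Finsupp.single k 1)) :
    Summable fun k => B (annihilation j (Finsupp.single k 1))
      (annihilation j (Finsupp.single k 1)) := by
  have h : HasTrace ((B.compl₂ (annihilation j)).compl₂ (creation j)) _ :=
    hasSum_of_eq (hN.add h1).hasSum (fun k => by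
      simp [annihilation_creation_single, -Finsupp.smul_single, add_mul]) rfl
  exact ((hasTrace_comp_left_annihilation_iff _ j _).2 h).summable

theorem IsPosForm.exists_first_moments {m : ℕ} {B : Form m} (hB : IsPosForm B)
    (h1 : Summable fun k : Fin m → ℕ => B (Finsupp.single k 1) (Finsupp.single k 1))
    (hN : ∀ j, Summable fun k : Fin m → ℕ =>
      (k j : ℂ) * B (Finsupp.single k 1) (Finsupp.single k 1)) (p : Ix m) :
    ∃ x, HasTrace (mulVar p B) x := by
  rcases p with j | j
  · exact hB.exists_hasTrace (R := 1) (S := annihilation j) (fun k => rfl) h1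
      (summable_annihilation j h1 (hN j))
  · exact hB.exists_hasTrace (R := annihilation j) (S := 1) (fun k => rfl)
      (summable_annihilation j h1 (hN j)) h1

theorem IsPosForm.exists_second_moments {m : ℕ} {B : Form m} (hB : IsPosForm B)
    (h1 : Summable fun k : Fin m → ℕ => B (Finsupp.single k 1) (Finsupp.single k 1))
    (hN : ∀ j, Summable fun k : Fin m → ℕ =>
      (k j : ℂ) * B (Finsupp.single k 1) (Finsupp.single k 1)) (p q : Ix m) :
    ∃ x, HasTrace (mulVar p (mulVar q B)) x := by
  have ha := fun j => summable_annihilation j h1 (hN j)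
  have hc := fun j => summable_creation j (hN j)
  rcases p with i | i <;> rcases q with j | j
  -- With two annihilators on the same side, the direct bound would need fourth moments. Cyclicity
  -- moves one across as a creator, so that only one ladder operator acts on each vector.
  · obtain ⟨x, hx⟩ := hB.exists_hasTrace (K := (mulVar (Sum.inl j) B).comp (creation i))
      (R := creation i) (S := annihilation j) (fun k => rfl) (hc i) (ha j)
    exact ⟨x, (hasTrace_comp_left_creation_iff _ _ _).1 hx⟩
  · exact hB.exists_hasTrace (R := annihilation j) (S := annihilation i) (fun k => rfl) (ha j) (ha i)
  · exact hB.exists_hasTrace (R := annihilation i) (S := annihilation j) (fun k => rfl) (ha i) (ha j)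
  · obtain ⟨x, hx⟩ := hB.exists_hasTrace (K := (mulVar (Sum.inr j) B).compl₂ (creation i))
      (R := annihilation j) (S := creation i) (fun k => rfl) (ha j) (hc i)
    exact ⟨x, (hasTrace_comp_left_annihilation_iff _ _ _).2 hx⟩

/-! ### Expectation values of polynomials in the quadratures -/

/-- The expectation value of `R` in the form `B` exists and is equal to `x`. -/
def HasExp {m : ℕ} (B : Form m) (R : Module.End ℂ (FiniteFock m)) (x : ℂ) : Prop :=
  HasTrace (B.compl₂ R) x

theorem HasExp.add {m : ℕ} {B : Form m} {R S : Module.End ℂ (FiniteFock m)} {x y : ℂ}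
    (hR : HasExp B R x) (hS : HasExp B S y) : HasExp B (R + S) (x + y) :=
  hasSum_of_eq (HasSum.add hR hS) (fun k => by simp) rfl

theorem HasExp.sub {m : ℕ} {B : Form m} {R S : Module.End ℂ (FiniteFock m)} {x y : ℂ}
    (hR : HasExp B R x) (hS : HasExp B S y) : HasExp B (R - S) (x - y) :=
  hasSum_of_eq (HasSum.sub hR hS) (fun k => by simp) rfl

theorem HasExp.smul {m : ℕ} {B : Form m} {R : Module.End ℂ (FiniteFock m)} {x : ℂ} (c : ℂ)
    (hR : HasExp B R x) : HasExp B (c • R) (c * x) :=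
  hasSum_of_eq (HasSum.mul_left c hR) (fun k => by simp) rfl

theorem HasExp.sum {m : ℕ} {B : Form m} {ι : Type*} {s : Finset ι}
    {R : ι → Module.End ℂ (FiniteFock m)} {x : ι → ℂ} (h : ∀ i, HasExp B (R i) (x i)) :
    HasExp B (∑ i ∈ s, R i) (∑ i ∈ s, x i) :=
  hasSum_of_eq (hasSum_sum fun i _ => h i) (fun k => by simp [LinearMap.sum_apply]) rfl

theorem HasExp.of_eq {m : ℕ} {B : Form m} {R S : Module.End ℂ (FiniteFock m)} {x y : ℂ}
    (h : HasExp B R x) (hR : S = R) (hx : y = x) : HasExp B S y := hR ▸ hx ▸ h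

theorem HasExp.one {m : ℕ} {B : Form m} {x : ℂ} (h : HasTrace B x) : HasExp B 1 x := h

theorem symmProd_sub_smul_one {E : Type*} [Ring E] [Algebra ℂ E] (a b : E) (s t : ℂ) :
    (1 / 2 : ℂ) • ((a - s • 1) * (b - t • 1) + (b - t • 1) * (a - s • 1)) =
      (1 / 2 : ℂ) • ((a * b + b * a) - ((2 * t) • a + (2 * s) • b) + (2 * s * t) • 1) := by
  simp only [mul_sub, sub_mul, smul_mul_assoc, mul_smul_comm, one_mul, mul_one]
  module

theorem smul_sum_sub_smul_one {E ι : Type*} [Fintype ι] [Ring E] [Algebra ℂ E] (L : ι → E)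
    (u t : ι → ℂ) (r : ℂ) :
    r • ∑ p, u p • L p - (r • ∑ p, u p * t p) • (1 : E) = r • ∑ p, u p • (L p - t p • 1) := by
  simp only [smul_sub, Finset.sum_sub_distrib, smul_eq_mul, mul_smul, Finset.sum_smul]

theorem symmProd_sum {E ι : Type*} [Fintype ι] [Ring E] [Algebra ℂ E] (L : ι → E) (u v : ι → ℂ)
    (r : ℂ) :
    (1 / 2 : ℂ) • ((r • ∑ p, u p • L p) * (r • ∑ p, v p • L p) +
        (r • ∑ p, v p • L p) * (r • ∑ p, u p • L p)) =
      (r * r) • ∑ p, ∑ q, (u p * v q) • (1 / 2 : ℂ) • (L p * L q + L q * L p) := by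
  have hmul : ∀ u v : ι → ℂ, (r • ∑ p, u p • L p) * (r • ∑ p, v p • L p) =
      (r * r) • ∑ p, ∑ q, (u p * v q) • (L p * L q) := by
    intro u v
    rw [smul_mul_smul_comm, Finset.sum_mul_sum]
    simp only [smul_mul_smul_comm]
  rw [hmul, hmul, Finset.sum_comm (f := fun p q => (v p * u q) • (L p * L q)),
    ← smul_add, smul_comm, ← Finset.sum_add_distrib, Finset.smul_sum]
  congr 1
  refine Finset.sum_congr rfl fun p _ => ?_
  rw [← Finset.sum_add_distrib, Finset.smul_sum]
  refine Finset.sum_congr rfl fun q _ => ?_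
  rw [mul_comm (v q), ← smul_add, smul_comm]

/-- The ladder operators `(a, a†)`. -/
def ladder {m : ℕ} : Ix m → Module.End ℂ (FiniteFock m)
  | Sum.inl j => annihilation j
  | Sum.inr j => creation j

theorem hasExp_ladder {m : ℕ} {B : Form m} {t : Ix m → ℂ} (ht : ∀ p, HasTrace (mulVar p B) (t p))
    (p : Ix m) : HasExp B (ladder p) (t p) := by
  rcases p with j | j
  · exact ht (Sum.inl j)
  · exact (hasTrace_derivVar_iff (Sum.inl j) B _).2 (ht (Sum.inr j))

/-- `M` holds antinormally ordered moments, since `w` puts `a` to the right of the operator and `z`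
puts `a†` to its left. Only the order `a† a` needs a commutator correction. -/
theorem hasExp_ladder_mul {m : ℕ} {B : Form m} {M : Matrix (Ix m) (Ix m) ℂ} (h1 : HasTrace B 1)
    (hM : ∀ p q, HasTrace (mulVar p (mulVar q B)) (M p q)) (p q : Ix m) :
    HasExp B (ladder p * ladder q)
      (M p q - Matrix.fromBlocks (0 : Matrix (Fin m) (Fin m) ℂ) 0 1 0 p q) := by
  rcases p with i | i <;> rcases q with j | j
  · have h := hM (Sum.inl i) (Sum.inl j)
    rw [mulVar_comm] at h
    exact hasSum_of_eq h (fun k => rfl) (by simp)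
  · have h : HasTrace (derivVar (Sum.inl j) (mulVar (Sum.inl i) B)) (M (Sum.inl i) (Sum.inr j)) := by
      rw [hasTrace_derivVar_iff, mulVar_comm]
      exact hM _ _
    exact hasSum_of_eq h (fun k => rfl) (by simp)
  · have h : HasTrace (mulVar (Sum.inl j) (derivVar (Sum.inl i) B))
        (M (Sum.inr i) (Sum.inl j) - (if Sum.inl j = (Sum.inl i : Ix m) then 1 else 0) * 1) := by
      rw [mulVar_derivVar]
      refine HasTrace.sub ?_ (h1.smul _)
      rw [hasTrace_derivVar_iff]
      exact hM (Sum.inr i) (Sum.inl j)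
    exact hasSum_of_eq h (fun k => rfl) (by simp [Matrix.one_apply, eq_comm])
  · have h : HasTrace (derivVar (Sum.inl j) (derivVar (Sum.inl i) B))
        (M (Sum.inr i) (Sum.inr j)) := by
      have h2 := mulVar_derivVar (Sum.inr j) (Sum.inl i) B
      rw [if_neg (by simp), zero_smul, sub_zero] at h2
      rw [hasTrace_derivVar_iff, Sum.swap_inl, h2, hasTrace_derivVar_iff]
      exact hM _ _
    exact hasSum_of_eq h (fun k => rfl) (by simp)

/-- Averaging the two orders spreads the commutator correction evenly over the off-diagonal blocks,
which gives half of `swapX m`. -/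
theorem hasExp_ladder_cov {m : ℕ} {B : Form m} {t : Ix m → ℂ} {M : Matrix (Ix m) (Ix m) ℂ}
    (h1 : HasTrace B 1) (ht : ∀ p, HasTrace (mulVar p B) (t p))
    (hM : ∀ p q, HasTrace (mulVar p (mulVar q B)) (M p q)) (p q : Ix m) :
    HasExp B ((1 / 2 : ℂ) • ((ladder p - t p • 1) * (ladder q - t q • 1) +
        (ladder q - t q • 1) * (ladder p - t p • 1)))
      ((M - Matrix.vecMulVec t t - (1 / 2 : ℂ) • swapX m) p q) := by
  have hs : M q p = M p q := by
    refine (hM q p).unique ?_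
    rw [mulVar_comm]
    exact hM p q
  have hX : swapX m p q = Matrix.fromBlocks (0 : Matrix (Fin m) (Fin m) ℂ) 0 1 0 p q +
      Matrix.fromBlocks (0 : Matrix (Fin m) (Fin m) ℂ) 0 1 0 q p := by
    rcases p with i | i <;> rcases q with j | j <;> simp [swapX, Matrix.one_apply, eq_comm]
  have h := ((((hasExp_ladder_mul h1 hM p q).add (hasExp_ladder_mul h1 hM q p)).sub
    (((hasExp_ladder ht p).smul (2 * t q)).add ((hasExp_ladder ht q).smul (2 * t p)))).add
    ((HasExp.one h1).smul (2 * t p * t q))).smul (1 / 2)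
  refine h.of_eq ?_ ?_
  · exact symmProd_sub_smul_one (E := Module.End ℂ (FiniteFock m)) _ _ _ _
  · simp only [Matrix.sub_apply, Matrix.smul_apply, Matrix.vecMulVec_apply, hX, hs, smul_eq_mul]
    ring

theorem quadrature_eq {m : ℕ} (ħ : ℝ) (i : Ix m) :
    quadrature ħ i = (Real.sqrt ħ : ℂ) • ∑ p, (W m)ᴴ i p • ladder p := by
  have h2 : (Real.sqrt (ħ / 2) : ℂ) = Real.sqrt ħ * (Real.sqrt 2 : ℂ)⁻¹ := by
    rw [Real.sqrt_div' _ (by norm_num)]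
    push_cast
    rw [div_eq_mul_inv]
  rcases i with j | j
  · have hl : ∀ p, (W m)ᴴ (Sum.inl j) p = if p = Sum.inl j ∨ p = Sum.inr j then
        (Real.sqrt 2 : ℂ)⁻¹ else 0 := by
      rintro (p | p) <;> by_cases hp : p = j <;> simp [hp, W, Matrix.conjTranspose_apply, mul_comm]
    simp only [quadrature, h2, Fintype.sum_sum_type, hl, ladder, ite_smul, zero_smul]
    simp [-Complex.coe_smul]
    module
  · have hl : ∀ p, (W m)ᴴ (Sum.inr j) p = if p = Sum.inl j then -Complex.I * (Real.sqrt 2 : ℂ)⁻¹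
        else if p = Sum.inr j then Complex.I * (Real.sqrt 2 : ℂ)⁻¹ else 0 := by
      rintro (p | p) <;> by_cases hp : p = j <;> simp [hp, W, Matrix.conjTranspose_apply, mul_comm]
    simp only [quadrature, h2, Fintype.sum_sum_type, hl, ladder, ite_smul, zero_smul]
    simp [-Complex.coe_smul]
    module

theorem hasExp_quadrature {m : ℕ} {B : Form m} {t : Ix m → ℂ} (ħ : ℝ)
    (ht : ∀ p, HasTrace (mulVar p B) (t p)) (i : Ix m) :
    HasExp B (quadrature ħ i) (((Real.sqrt ħ : ℂ) • ((W m)ᴴ *ᵥ t)) i) := by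
  rw [quadrature_eq]
  exact (HasExp.sum fun p => (hasExp_ladder ht p).smul ((W m)ᴴ i p)).smul _

/-- The covariance is bilinear in the quadratures, hence the transpose of `Wᴴ` on the right rather
than its adjoint. -/
theorem hasExp_quadrature_cov {m : ℕ} {B : Form m} {t : Ix m → ℂ} {M : Matrix (Ix m) (Ix m) ℂ}
    {ħ : ℝ} (hħ : 0 ≤ ħ) (h1 : HasTrace B 1) (ht : ∀ p, HasTrace (mulVar p B) (t p))
    (hM : ∀ p q, HasTrace (mulVar p (mulVar q B)) (M p q)) {μ : Ix m → ℂ}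
    (hμ : μ = (Real.sqrt ħ : ℂ) • ((W m)ᴴ *ᵥ t)) (i j : Ix m) :
    HasExp B ((1 / 2 : ℂ) • ((quadrature ħ i - μ i • 1) * (quadrature ħ j - μ j • 1) +
        (quadrature ħ j - μ j • 1) * (quadrature ħ i - μ i • 1)))
      (((ħ : ℂ) • ((W m)ᴴ * (M - Matrix.vecMulVec t t - (1 / 2 : ℂ) • swapX m) * ((W m)ᴴ)ᵀ)) i j)
      := by
  have hq : ∀ i, quadrature ħ i - μ i • 1 =
      (Real.sqrt ħ : ℂ) • ∑ p, (W m)ᴴ i p • (ladder p - t p • 1) := by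
    intro i
    rw [quadrature_eq, hμ]
    exact smul_sum_sub_smul_one (E := Module.End ℂ (FiniteFock m)) _ _ _ _
  have hss : (Real.sqrt ħ : ℂ) * Real.sqrt ħ = ħ := by
    rw [← Complex.ofReal_mul, Real.mul_self_sqrt hħ]
  have h := (HasExp.sum (s := Finset.univ) fun p => HasExp.sum (s := Finset.univ) fun q =>
    (hasExp_ladder_cov h1 ht hM p q).smul ((W m)ᴴ i p * (W m)ᴴ j q)).smul (ħ : ℂ)
  refine h.of_eq ?_ ?_
  · rw [hq, hq]
    have key := symmProd_sum (E := Module.End ℂ (FiniteFock m)) (fun p => ladder p - t p • 1)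
      ((W m)ᴴ i) ((W m)ᴴ j) (Real.sqrt ħ : ℂ)
    rw [hss] at key
    exact key
  · simp only [Matrix.smul_apply, Matrix.mul_apply, Matrix.transpose_apply, smul_eq_mul]
    congr 1
    rw [Finset.sum_comm]
    refine Finset.sum_congr rfl fun q _ => ?_
    rw [Finset.sum_mul]
    refine Finset.sum_congr rfl fun p _ => ?_
    rw [mul_right_comm]

/-! ### The form of an operator -/

theorem toFock_single {m : ℕ} (k : Fin m → ℕ) :
    toFock (Finsupp.single k (1 : ℂ)) = numberKet k := by
  simp [toFock, Finsupp.linearCombination_single]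

/-- The form `⟨u| T |v⟩` of a bounded operator. -/
def form {m : ℕ} (T : FockSpace m →L[ℂ] FockSpace m) : Form m :=
  LinearMap.mk₂'ₛₗ (starRingEnd ℂ) (RingHom.id ℂ) (fun u v => inner ℂ (toFock u) (T (toFock v)))
    (fun u v w => by simp) (fun c u v => by simp [mul_comm]) (fun u v w => by simp)
    (fun c u v => by simp)

theorem form_apply {m : ℕ} (T : FockSpace m →L[ℂ] FockSpace m) (u v : FiniteFock m) :
    form T u v = inner ℂ (toFock u) (T (toFock v)) := rfl

theorem form_single {m : ℕ} (T : FockSpace m →L[ℂ] FockSpace m) (k l : Fin m → ℕ) :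
    form T (Finsupp.single k 1) (Finsupp.single l 1) = inner ℂ (numberKet k) (T (numberKet l)) := by
  rw [form_apply, toFock_single, toFock_single]

theorem isPosForm_form {m : ℕ} {T : FockSpace m →L[ℂ] FockSpace m} (hT : T.IsPositive) :
    IsPosForm (form T) where
  conj_symm u v := by
    rw [form_apply, form_apply, inner_conj_symm, hT.inner_left_eq_inner_right]
  nonneg u := hT.re_inner_nonneg_right _

theorem hasExpectation_iff {m : ℕ} (ρ : TraceClass m) (R : Module.End ℂ (FiniteFock m)) (x : ℝ) :
    HasExpectation ρ R x ↔ HasExp (form ρ.1) R (x : ℂ) := by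
  unfold HasExpectation HasExp HasTrace
  simp only [LinearMap.compl₂_apply, form_apply, toFock_single]

theorem form_ext {m : ℕ} {K L : Form m}
    (h : ∀ k l, K (Finsupp.single k 1) (Finsupp.single l 1) =
      L (Finsupp.single k 1) (Finsupp.single l 1)) : K = L := by
  refine LinearMap.ext₂ fun u v => ?_
  induction u using Finsupp.induction_linear with
  | zero => simp
  | add u₁ u₂ h1 h2 => simp [h1, h2]
  | single k c =>
    induction v using Finsupp.induction_linear with
    | zero => simp
    | add v₁ v₂ h1 h2 => simp [h1, h2]
    | single l d =>
      have hk : Finsupp.single k c = c • Finsupp.single k (1 : ℂ) := by simp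
      have hl : Finsupp.single l d = d • Finsupp.single l (1 : ℂ) := by simp
      rw [hk, hl, LinearMap.map_smulₛₗ K, LinearMap.map_smulₛₗ L, LinearMap.smul_apply,
        LinearMap.smul_apply, map_smul, map_smul, h]

/-! ### Bargmann functions as power series -/

/-- The unnormalized coherent state `exp(‖z‖² / 2) |z⟩`. -/
def bargmannKet {m : ℕ} (z : Fin m → ℂ) : FockSpace m := bargmannFactor z • coherentKet z

theorem bargmannFactor_ne_zero {m : ℕ} (z : Fin m → ℂ) : bargmannFactor z ≠ 0 :=
  Complex.ofReal_ne_zero.2 (Real.exp_pos _).ne'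

theorem bargmannKet_apply {m : ℕ} (z : Fin m → ℂ) (k : Fin m → ℕ) :
    bargmannKet z k = ∏ j, z j ^ k j / (Real.sqrt ((k j).factorial : ℝ) : ℂ) := by
  change bargmannFactor z * coherentAmplitude z k = _
  rw [bargmannFactor, coherentAmplitude, ← mul_assoc, ← Complex.ofReal_mul, ← Real.exp_add]
  simp [neg_div]

theorem bargmannKet_star_apply {m : ℕ} (z : Fin m → ℂ) (k : Fin m → ℕ) :
    (starRingEnd ℂ) (bargmannKet (star z) k) = bargmannKet z k := by
  simp [bargmannKet_apply, map_prod]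

theorem bargmannFactor_star {m : ℕ} (z : Fin m → ℂ) :
    bargmannFactor (star z) = bargmannFactor z := by
  simp [bargmannFactor]

theorem bargmannOp_eq {m : ℕ} (T : TraceClass m) (w z : Fin m → ℂ) :
    bargmannOp T w z = inner ℂ (bargmannKet (star z)) (T.1 (bargmannKet w)) := by
  rw [bargmannOp, bargmannKet, bargmannKet, map_smul, inner_smul_left, inner_smul_right,
    bargmannFactor_star]
  simp only [bargmannFactor, Complex.conj_ofReal]
  ring

theorem hasSum_bargmannKet {m : ℕ} (z : Fin m → ℂ) :
    HasSum (fun k => bargmannKet z k • numberKet k) (bargmannKet z) := by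
  have h := lp.hasSum_single (E := fun _ : Fin m → ℕ => ℂ) (p := 2) (by simp) (bargmannKet z)
  convert h using 2 with k
  rw [numberKet, ← lp.single_smul]
  simp

theorem hasSum_inner_bargmannKet_star {m : ℕ} (z : Fin m → ℂ) (u : FockSpace m) :
    HasSum (fun k => bargmannKet z k * inner ℂ (numberKet k) u)
      (inner ℂ (bargmannKet (star z)) u) := by
  refine hasSum_of_eq (lp.hasSum_inner (bargmannKet (star z)) u) (fun k => ?_) rfl
  rw [inner_numberKet, ← bargmannKet_star_apply]
  simp [mul_comm]

/-- The term is the product of `(2x)ⁿ/√n!` and `2⁻ⁿ`, both square-summable, so it is bounded by the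
sum of their squares. -/
theorem summable_pow_div_sqrt_factorial (x : ℝ) (hx : 0 ≤ x) :
    Summable fun n : ℕ => x ^ n / Real.sqrt (n.factorial : ℝ) := by
  refine Summable.of_nonneg_of_le (fun n => by positivity) (fun n => ?_)
    ((Real.summable_pow_div_factorial (4 * x ^ 2)).add
      (summable_geometric_of_lt_one (r := (1 / 4 : ℝ)) (by norm_num) (by norm_num)))
  have h1 : (4 * x ^ 2) ^ n / (n.factorial : ℝ) =
      ((2 * x) ^ n / Real.sqrt (n.factorial : ℝ)) ^ 2 := by
    rw [div_pow, Real.sq_sqrt (by positivity), ← pow_mul, mul_comm n 2, pow_mul]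
    ring
  have h2 : (1 / 4 : ℝ) ^ n = ((1 / 2 : ℝ) ^ n) ^ 2 := by
    rw [← pow_mul, mul_comm n 2, pow_mul]
    norm_num
  have h3 : x ^ n / Real.sqrt (n.factorial : ℝ) =
      (2 * x) ^ n / Real.sqrt (n.factorial : ℝ) * (1 / 2 : ℝ) ^ n := by
    rw [div_mul_eq_mul_div, ← mul_pow]
    ring
  rw [h1, h2, h3]
  nlinarith [sq_nonneg ((2 * x) ^ n / Real.sqrt (n.factorial : ℝ) - (1 / 2 : ℝ) ^ n),
    sq_nonneg ((2 * x) ^ n / Real.sqrt (n.factorial : ℝ)), sq_nonneg ((1 / 2 : ℝ) ^ n)]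

theorem summable_norm_bargmannKet {m : ℕ} (z : Fin m → ℂ) :
    Summable fun k => ‖bargmannKet z k‖ := by
  refine (summable_pi_prod (fun j n => ‖z j‖ ^ n / Real.sqrt (n.factorial : ℝ))
    (fun j n => by positivity)
    (fun j => summable_pow_div_sqrt_factorial _ (norm_nonneg _))).congr fun k => ?_
  rw [bargmannKet_apply]
  simp [norm_prod, abs_of_nonneg (Real.sqrt_nonneg _)]

theorem norm_numberKet {m : ℕ} (k : Fin m → ℕ) : ‖numberKet k‖ = 1 := by
  rw [numberKet, lp.norm_single (by norm_num)]
  simp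

theorem norm_inner_numberKet_le {m : ℕ} (T : FockSpace m →L[ℂ] FockSpace m) (k l : Fin m → ℕ) :
    ‖(inner ℂ (numberKet k) (T (numberKet l)) : ℂ)‖ ≤ ‖T‖ := by
  refine (norm_inner_le_norm _ _).trans ?_
  rw [norm_numberKet, one_mul]
  simpa [norm_numberKet] using T.le_opNorm (numberKet l)

/-- Coherent amplitudes are even ℓ¹ and matrix elements are bounded by `‖T‖`, so the double series
converges absolutely; its value is found by summing over bras, then kets. -/
theorem hasSum_bargmannOp {m : ℕ} (T : TraceClass m) (w z : Fin m → ℂ) :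
    HasSum (fun kl : (Fin m → ℕ) × (Fin m → ℕ) => bargmannKet w kl.1 * (bargmannKet z kl.2 *
      inner ℂ (numberKet kl.2) (T.1 (numberKet kl.1)))) (bargmannOp T w z) := by
  have hs : Summable (fun kl : (Fin m → ℕ) × (Fin m → ℕ) => bargmannKet w kl.1 *
      (bargmannKet z kl.2 * inner ℂ (numberKet kl.2) (T.1 (numberKet kl.1)))) := by
    refine Summable.of_norm_bounded
      (((summable_norm_bargmannKet w).mul_of_nonneg (summable_norm_bargmannKet z)
        (fun _ => norm_nonneg _) (fun _ => norm_nonneg _)).mul_right ‖T.1‖) fun kl => ?_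
    rw [norm_mul, norm_mul, ← mul_assoc]
    gcongr
    exact norm_inner_numberKet_le _ _ _
  have h1 := hs.hasSum.prod_fiberwise fun l =>
    (hasSum_inner_bargmannKet_star z (T.1 (numberKet l))).mul_left (bargmannKet w l)
  have h2 : HasSum (fun l => bargmannKet w l * inner ℂ (bargmannKet (star z)) (T.1 (numberKet l)))
      (bargmannOp T w z) := by
    rw [bargmannOp_eq]
    refine hasSum_of_eq (((innerSL ℂ (bargmannKet (star z))).comp T.1).hasSum
      (hasSum_bargmannKet w)) (fun l => ?_) rfl
    simp
  rw [h2.unique h1]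
  exact hs.hasSum

/-- The matrix element of `T` with the bra and ket photon numbers in one multi-index. -/
def matrixElement {m : ℕ} (T : TraceClass m) (n : Ix m → ℕ) : ℂ :=
  inner ℂ (numberKet fun j => n (Sum.inr j)) (T.1 (numberKet fun j => n (Sum.inl j)))

/-- The weight `∏ᵢ 1 / √(nᵢ!)`. -/
def invSqrtFactorial {ι : Type*} [Fintype ι] (n : ι → ℕ) : ℂ :=
  ∏ i, (Real.sqrt ((n i).factorial : ℝ) : ℂ)⁻¹

theorem hasSum_bargmannOp_powerSeries {m : ℕ} (T : TraceClass m) (ζ : Ix m → ℂ) :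
    HasSum (fun n : Ix m → ℕ => matrixElement T n * invSqrtFactorial n * ∏ i, ζ i ^ n i)
      (bargmannOp T (fun j => ζ (Sum.inl j)) (fun j => ζ (Sum.inr j))) := by
  have h := (Equiv.sumArrowEquivProdArrow (Fin m) (Fin m) ℕ).hasSum_iff.2
    (hasSum_bargmannOp T (fun j => ζ (Sum.inl j)) (fun j => ζ (Sum.inr j)))
  refine hasSum_of_eq h (fun n => ?_) rfl
  simp only [Function.comp_apply, Equiv.sumArrowEquivProdArrow, Equiv.coe_fn_mk,
    bargmannKet_apply, matrixElement, invSqrtFactorial, Fintype.prod_sum_type, div_eq_mul_inv,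
    Finset.prod_mul_distrib]
  simp only [Function.comp_def]
  ring

theorem invSqrtFactorial_ne_zero {ι : Type*} [Fintype ι] (n : ι → ℕ) : invSqrtFactorial n ≠ 0 := by
  refine Finset.prod_ne_zero_iff.2 fun i _ => inv_ne_zero (Complex.ofReal_ne_zero.2 ?_)
  exact (Real.sqrt_pos.2 (by positivity)).ne'

theorem sqrt_mul_invSqrtFactorial_add_single {ι : Type*} [Fintype ι] [DecidableEq ι] (n : ι → ℕ)
    (i : ι) : (Real.sqrt ((n i : ℝ) + 1) : ℂ) * invSqrtFactorial (n + Pi.single i 1) =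
      invSqrtFactorial n := by
  rw [invSqrtFactorial, invSqrtFactorial, ← Finset.mul_prod_erase _ _ (Finset.mem_univ i),
    ← Finset.mul_prod_erase _ (fun j => (Real.sqrt ((n j).factorial : ℝ) : ℂ)⁻¹)
      (Finset.mem_univ i), ← mul_assoc]
  congr 1
  · have h : (Real.sqrt ((n i : ℝ) + 1) : ℂ) ≠ 0 :=
      Complex.ofReal_ne_zero.2 (Real.sqrt_pos.2 (by positivity)).ne'
    simp only [Pi.add_apply, Pi.single_eq_same, Nat.factorial_succ]
    push_cast
    rw [Real.sqrt_mul (by positivity)]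
    push_cast
    rw [mul_inv, ← mul_assoc, mul_inv_cancel₀ h, one_mul]
  · refine Finset.prod_congr rfl fun j hj => ?_
    simp [Finset.ne_of_mem_erase hj]

/-- Removing the weights `1/√n!` from `gaussianFun_coeff` produces exactly the square roots of the
ladder operators. -/
theorem matrixElement_recursion {m : ℕ} {T : TraceClass m} {A : Matrix (Ix m) (Ix m) ℂ}
    {b : Ix m → ℂ} {c : ℂ} (hA : A.IsSymm)
    (hT : ∀ w z, bargmannOp T w z = gaussianFun A b c (Sum.elim w z)) (p : Ix m) (n : Ix m → ℕ) :
    (Real.sqrt ((n p : ℝ) + 1) : ℂ) * matrixElement T (n + Pi.single p 1) =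
      ∑ q, A p q * ((Real.sqrt (n q : ℝ) : ℂ) * matrixElement T (n - Pi.single q 1)) +
        b p * matrixElement T n := by
  have hf : ∀ ζ : Ix m → ℂ, HasSum (fun n : Ix m → ℕ => matrixElement T n * invSqrtFactorial n *
      ∏ i, ζ i ^ n i) (gaussianFun A b c ζ) := by
    intro ζ
    have h := hasSum_bargmannOp_powerSeries T ζ
    rw [hT] at h
    convert h using 2
    funext p
    rcases p with j | j <;> rfl
  have h := gaussianFun_coeff hA hf p n
  refine mul_right_cancel₀ (invSqrtFactorial_ne_zero n) ?_
  have hsq : (Real.sqrt ((n p : ℝ) + 1) : ℂ) * (Real.sqrt ((n p : ℝ) + 1) : ℂ) = n p + 1 := by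
    rw [← Complex.ofReal_mul, Real.mul_self_sqrt (by positivity)]
    push_cast
    rfl
  have hl : (Real.sqrt ((n p : ℝ) + 1) : ℂ) * matrixElement T (n + Pi.single p 1) *
      invSqrtFactorial n = (n p + 1 : ℂ) * (matrixElement T (n + Pi.single p 1) *
        invSqrtFactorial (n + Pi.single p 1)) := by
    rw [← sqrt_mul_invSqrtFactorial_add_single n p, ← hsq]
    ring
  rw [hl, h, add_mul, Finset.sum_mul, mul_assoc (b p)]
  congr 1
  refine Finset.sum_congr rfl fun q _ => ?_
  rw [mul_assoc]
  congr 1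
  by_cases hq : n q = 0
  · simp [hq]
  · have h2 := sqrt_mul_invSqrtFactorial_add_single (n - Pi.single q 1) q
    have h3 : ((n - Pi.single q 1 : Ix m → ℕ) q : ℝ) + 1 = n q := by
      have := congrFun (sub_single_add_single hq) q
      rw [← this]
      simp
    rw [h3, sub_single_add_single hq] at h2
    rw [if_neg hq, ← h2]
    ring

theorem matrixElement_elim {m : ℕ} (T : TraceClass m) (k l : Fin m → ℕ) :
    matrixElement T (Sum.elim l k) = form T.1 (Finsupp.single k 1) (Finsupp.single l 1) :=
  (form_single _ _ _).symm

theorem isGaussianForm_form {m : ℕ} {T : TraceClass m} {A : Matrix (Ix m) (Ix m) ℂ}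
    {b : Ix m → ℂ} {c : ℂ} (hA : A.IsSymm)
    (hT : ∀ w z, bargmannOp T w z = gaussianFun A b c (Sum.elim w z)) :
    IsGaussianForm (form T.1) A b := by
  intro p
  refine form_ext fun k l => ?_
  have hmul : ∀ q, mulVar q (form T.1) (Finsupp.single k 1) (Finsupp.single l 1) =
      (Real.sqrt ((Sum.elim l k q : ℕ) : ℝ) : ℂ) *
        matrixElement T (Sum.elim l k - Pi.single q 1) := by
    rintro (j | j)
    · have : (Sum.elim l k - Pi.single (Sum.inl j) 1 : Ix m → ℕ) =
          Sum.elim (l - Pi.single j 1) k := by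
        funext q
        rcases q with q | q <;> simp [Pi.single_apply]
      rw [this, matrixElement_elim, mulVar_inl_apply, annihilation_single, map_smul]
      rfl
    · have : (Sum.elim l k - Pi.single (Sum.inr j) 1 : Ix m → ℕ) =
          Sum.elim l (k - Pi.single j 1) := by
        funext q
        rcases q with q | q <;> simp [Pi.single_apply]
      rw [this, matrixElement_elim, mulVar_inr_apply, annihilation_single, LinearMap.map_smulₛₗ,
        Complex.conj_ofReal]
      rfl
  have hder : derivVar p (form T.1) (Finsupp.single k 1) (Finsupp.single l 1) =
      (Real.sqrt (((Sum.elim l k p : ℕ) : ℝ) + 1) : ℂ) *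
        matrixElement T (Sum.elim l k + Pi.single p 1) := by
    rcases p with j | j
    · have : (Sum.elim l k + Pi.single (Sum.inl j) 1 : Ix m → ℕ) =
          Sum.elim (l + Pi.single j 1) k := by
        funext q
        rcases q with q | q <;> simp [Pi.single_apply]
      rw [this, matrixElement_elim, derivVar_inl_apply, creation_single, map_smul]
      rfl
    · have : (Sum.elim l k + Pi.single (Sum.inr j) 1 : Ix m → ℕ) =
          Sum.elim l (k + Pi.single j 1) := by
        funext q
        rcases q with q | q <;> simp [Pi.single_apply]
      rw [this, matrixElement_elim, derivVar_inr_apply, creation_single, LinearMap.map_smulₛₗ,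
        Complex.conj_ofReal]
      rfl
  rw [hder, matrixElement_recursion hA hT, matrixElement_elim]
  simp only [LinearMap.add_apply, LinearMap.sum_apply, LinearMap.smul_apply, smul_eq_mul, hmul]

/-! ### Coherent states -/

theorem hasSum_pi_prod {m : ℕ} (f : Fin m → ℕ → ℂ) (a : Fin m → ℂ)
    (hs : ∀ j, Summable fun n => ‖f j n‖) (h : ∀ j, HasSum (f j) (a j)) :
    HasSum (fun k : Fin m → ℕ => ∏ j, f j (k j)) (∏ j, a j) := by
  induction m with
  | zero => simp
  | succ m ih =>
    have h2 := ih (fun j => f j.succ) (fun j => a j.succ) (fun j => hs _) (fun j => h _)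
    have hs2 : Summable fun k : Fin m → ℕ => ‖∏ j, f j.succ (k j)‖ := by
      simp only [norm_prod]
      exact summable_pi_prod (fun j n => ‖f j.succ n‖) (fun j n => norm_nonneg _) (fun j => hs _)
    set g : (Fin m → ℕ) → ℂ := fun k => ∏ j, f j.succ (k j) with hg
    have hprod : Summable fun x : ℕ × (Fin m → ℕ) => f 0 x.1 * g x.2 :=
      summable_mul_of_summable_norm (hs 0) hs2
    have h3 := (h 0).mul h2 hprod
    let e : (Fin (m + 1) → ℕ) ≃ ℕ × (Fin m → ℕ) := (Fin.consEquiv fun _ : Fin (m + 1) => ℕ).symm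
    have h4 := e.hasSum_iff.2 h3
    refine hasSum_of_eq h4 (fun k => ?_) (Fin.prod_univ_succ a)
    rw [Fin.prod_univ_succ]
    rfl

theorem inner_bargmannKet_star {m : ℕ} (z α : Fin m → ℂ) :
    (inner ℂ (bargmannKet (star z)) (bargmannKet α) : ℂ) = Complex.exp (z ⬝ᵥ α) := by
  have h := hasSum_inner_bargmannKet_star z (bargmannKet α)
  have h2 := hasSum_pi_prod (fun j n => (z j * α j) ^ n / (n.factorial : ℂ))
    (fun j => Complex.exp (z j * α j)) (fun j => NormedSpace.norm_expSeries_div_summable _)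
    (fun j => by
      rw [Complex.exp_eq_exp_ℂ]
      exact NormedSpace.expSeries_div_hasSum_exp _)
  rw [dotProduct, Complex.exp_sum]
  refine h.unique (hasSum_of_eq h2 (fun k => ?_) rfl)
  rw [inner_numberKet, bargmannKet_apply, bargmannKet_apply, ← Finset.prod_mul_distrib]
  refine Finset.prod_congr rfl fun j _ => ?_
  rw [div_mul_div_comm, ← mul_pow, ← Complex.ofReal_mul, Real.mul_self_sqrt (by positivity)]
  norm_num

theorem coherentKet_eq {m : ℕ} (α : Fin m → ℂ) :
    coherentKet α = (bargmannFactor α)⁻¹ • bargmannKet α := by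
  rw [bargmannKet, smul_smul, inv_mul_cancel₀ (bargmannFactor_ne_zero α), one_smul]

theorem inner_coherentKet_self {m : ℕ} (α : Fin m → ℂ) :
    (inner ℂ (coherentKet α) (coherentKet α) : ℂ) = 1 := by
  have h := inner_bargmannKet_star (star α) α
  rw [star_star] at h
  have hsq : Complex.exp (star α ⬝ᵥ α) = bargmannFactor α * bargmannFactor α := by
    rw [bargmannFactor, ← Complex.ofReal_mul, ← Real.exp_add, add_halves, Complex.ofReal_exp]
    congr 1
    simp [dotProduct, ← Complex.normSq_eq_conj_mul_self, Complex.normSq_eq_norm_sq]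
  have hc : (starRingEnd ℂ) (bargmannFactor α)⁻¹ = (bargmannFactor α)⁻¹ := by
    rw [map_inv₀, bargmannFactor, Complex.conj_ofReal]
  rw [coherentKet_eq, inner_smul_left, inner_smul_right, h, hsq, hc]
  field_simp [bargmannFactor_ne_zero α]

theorem inner_ketBra_self {m : ℕ} (u : FockSpace m) (k : Fin m → ℕ) :
    (inner ℂ (numberKet k) ((ketBra u u).1 (numberKet k)) : ℂ) = (‖u k‖ ^ 2 : ℝ) := by
  change (inner ℂ (numberKet k) (InnerProductSpace.rankOne ℂ u u (numberKet k)) : ℂ) = _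
  rw [InnerProductSpace.rankOne_apply, inner_smul_right, ← inner_conj_symm u, inner_numberKet,
    mul_comm, Complex.mul_conj, Complex.normSq_eq_norm_sq]

theorem isPositive_ketBra {m : ℕ} (u : FockSpace m) : (ketBra u u).1.IsPositive :=
  InnerProductSpace.isPositive_rankOne_self u

theorem trace_coherent {m : ℕ} (α : Fin m → ℂ) :
    trace (ketBra (coherentKet α) (coherentKet α)) = 1 := by
  refine HasSum.tsum_eq ?_
  rw [← inner_coherentKet_self α]
  refine hasSum_of_eq (lp.hasSum_inner (coherentKet α) (coherentKet α)) (fun k => ?_) rfl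
  rw [inner_ketBra_self]
  simp

theorem bargmannOp_coherent {m : ℕ} (α w z : Fin m → ℂ) :
    bargmannOp (ketBra (coherentKet α) (coherentKet α)) w z =
      gaussianFun 0 (Sum.elim (star α) α) ((bargmannFactor α)⁻¹ * (bargmannFactor α)⁻¹)
        (Sum.elim w z) := by
  have hc : (starRingEnd ℂ) (bargmannFactor α)⁻¹ = (bargmannFactor α)⁻¹ := by
    rw [map_inv₀, bargmannFactor, Complex.conj_ofReal]
  have h := inner_bargmannKet_star (star α) w
  rw [star_star] at h
  rw [bargmannOp_eq]
  change (inner ℂ (bargmannKet (star z))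
    (InnerProductSpace.rankOne ℂ (coherentKet α) (coherentKet α) (bargmannKet w)) : ℂ) = _
  rw [InnerProductSpace.rankOne_apply, inner_smul_right, coherentKet_eq, inner_smul_left,
    inner_smul_right, h, inner_bargmannKet_star, hc, gaussianFun, Matrix.zero_mulVec,
    dotProduct_zero, mul_zero, zero_add, sumElim_dotProduct_sumElim, Complex.exp_add,
    dotProduct_comm w]
  ring

theorem isGaussianState_coherent {m : ℕ} (α : Fin m → ℂ) :
    IsGaussianState (ketBra (coherentKet α) (coherentKet α)) :=
  ⟨⟨isPositive_ketBra _, trace_coherent α⟩, 0, _, _, Matrix.isSymm_zero, bargmannOp_coherent α⟩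

/-- Doubling `α` multiplies the amplitude at `k` by `2^|k|`, whose square dominates `k j`; the
doubled vector is still square-summable. -/
theorem summable_number_coherent {m : ℕ} (α : Fin m → ℂ) (j : Fin m) :
    Summable fun k : Fin m → ℕ => (k j : ℂ) * inner ℂ (numberKet k)
      ((ketBra (coherentKet α) (coherentKet α)).1 (numberKet k)) := by
  refine Summable.of_norm_bounded
    ((summable_norm_sq (bargmannKet (2 • α))).mul_left (‖(bargmannFactor α)⁻¹‖ ^ 2)) fun k => ?_
  rw [inner_ketBra_self, coherentKet_eq]
  have hk : ‖bargmannKet (2 • α) k‖ = 2 ^ (∑ i, k i) * ‖bargmannKet α k‖ := by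
    rw [bargmannKet_apply, bargmannKet_apply, ← Finset.prod_pow_eq_pow_sum, norm_prod, norm_prod,
      ← Finset.prod_mul_distrib]
    refine Finset.prod_congr rfl fun i _ => ?_
    simp [mul_pow, mul_div_assoc]
  have hle : (k j : ℝ) ≤ (2 ^ (∑ i, k i)) ^ 2 := by
    have h1 : k j ≤ ∑ i, k i := Finset.single_le_sum (fun i _ => Nat.zero_le _) (Finset.mem_univ j)
    have h2 : (k j : ℝ) ≤ 2 ^ (∑ i, k i) := by
      exact_mod_cast h1.trans Nat.lt_two_pow_self.le
    have h3 : (1 : ℝ) ≤ 2 ^ (∑ i, k i) := one_le_pow₀ (by norm_num)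
    nlinarith
  have happ : ((bargmannFactor α)⁻¹ • bargmannKet α : FockSpace m) k =
      (bargmannFactor α)⁻¹ * bargmannKet α k := rfl
  rw [happ, hk, norm_mul, Complex.norm_natCast, Complex.norm_real, norm_mul, Real.norm_eq_abs,
    abs_of_nonneg (by positivity), mul_pow, mul_pow, mul_left_comm]
  gcongr

/-! ### Moments of Gaussian operators -/

theorem exists_gaussian_moments {m : ℕ} {σ : TraceClass m} {A : Matrix (Ix m) (Ix m) ℂ}
    {b : Ix m → ℂ} {c : ℂ} {ħ : ℝ} (hħ : 0 ≤ ħ) (hpos : σ.1.IsPositive) (htr : trace σ = 1)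
    (hA : A.IsSymm) (hσ : ∀ w z, bargmannOp σ w z = gaussianFun A b c (Sum.elim w z))
    (hN : ∀ j, Summable fun k : Fin m → ℕ =>
      (k j : ℂ) * inner ℂ (numberKet k) (σ.1 (numberKet k))) :
    ∃ (t : Ix m → ℂ) (C : Matrix (Ix m) (Ix m) ℂ), (swapX m - A) *ᵥ t = b ∧
      C * (swapX m - A) = 1 ∧
      (∀ i, HasExp (form σ.1) (quadrature ħ i) (((Real.sqrt ħ : ℂ) • ((W m)ᴴ *ᵥ t)) i)) ∧
      ∀ μ : Ix m → ℂ, μ = (Real.sqrt ħ : ℂ) • ((W m)ᴴ *ᵥ t) → ∀ i j, HasExp (form σ.1)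
        ((1 / 2 : ℂ) • ((quadrature ħ i - μ i • 1) * (quadrature ħ j - μ j • 1) +
          (quadrature ħ j - μ j • 1) * (quadrature ħ i - μ i • 1)))
        (((ħ : ℂ) • ((W m)ᴴ * (C - (1 / 2 : ℂ) • swapX m) * ((W m)ᴴ)ᵀ)) i j) := by
  have hB := isPosForm_form hpos
  have h1 : HasTrace (form σ.1) 1 := by
    -- A divergent `tsum` has the default value 0, so trace one forces summability.
    have hs : Summable fun k : Fin m → ℕ =>
        (inner ℂ (numberKet k) (σ.1 (numberKet k)) : ℂ) := by
      by_contra h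
      rw [trace, tsum_eq_zero_of_not_summable h] at htr
      exact zero_ne_one htr
    rw [← htr]
    exact hasSum_of_eq hs.hasSum (fun k => form_single _ _ _) rfl
  simp only [← form_single] at hN
  choose t ht using hB.exists_first_moments h1.summable hN
  choose M hM using hB.exists_second_moments h1.summable hN
  have hG := isGaussianForm_form hA hσ
  exact ⟨t, Matrix.of M - Matrix.vecMulVec t t, hG.first_moments h1 ht,
    hG.second_moments hA h1 ht hM, hasExp_quadrature ħ ht,
    fun μ hμ => hasExp_quadrature_cov hħ h1 ht hM hμ⟩

/-- This is `Q² + P² = ħ (a a† + a† a)` with `s² = ħ/2`, rewritten through centred second moments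
and means. -/
theorem number_eq_quadratures {E : Type*} [Ring E] [Algebra ℂ E] (a c Q P : E) (s μ ν : ℂ)
    (hQ : Q = s • (a + c)) (hP : P = (-Complex.I * s) • (a - c)) :
    (2 * (s * s)) • (a * c + c * a) =
      (1 / 2 : ℂ) • ((Q - μ • 1) * (Q - μ • 1) + (Q - μ • 1) * (Q - μ • 1)) +
      (1 / 2 : ℂ) • ((P - ν • 1) * (P - ν • 1) + (P - ν • 1) * (P - ν • 1)) +
      ((2 * μ) • Q + (2 * ν) • P) - (μ * μ + ν * ν) • 1 := by
  have hI : (-Complex.I * s) * (-Complex.I * s) = -(s * s) := by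
    linear_combination (s * s) * Complex.I_mul_I
  have hPP : P * P = -((s * s) • ((a - c) * (a - c))) := by
    rw [hP, smul_mul_smul_comm, hI, neg_smul]
  have hQQ : Q * Q = (s * s) • ((a + c) * (a + c)) := by
    rw [hQ, smul_mul_smul_comm]
  rw [symmProd_sub_smul_one, symmProd_sub_smul_one, hPP, hQQ]
  simp only [mul_sub, sub_mul, mul_add, add_mul]
  module

/-- The variances of `Q_j` and `P_j` exist by assumption, and their sum controls `ħ (2 N_j + 1)`. -/
theorem summable_number_of_hasCovariance {m : ℕ} {ħ : ℝ} (hħ : 0 < ħ) {σ : TraceClass m}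
    (htr : trace σ = 1) {μ : Ix m → ℝ} {S : Matrix (Ix m) (Ix m) ℝ} (hμ : HasMean ħ σ μ)
    (hS : HasCovariance ħ σ μ S) (j : Fin m) :
    Summable fun k : Fin m → ℕ => (k j : ℂ) * inner ℂ (numberKet k) (σ.1 (numberKet k)) := by
  have hs : Summable fun k : Fin m → ℕ =>
      (inner ℂ (numberKet k) (σ.1 (numberKet k)) : ℂ) := by
    by_contra h
    rw [trace, tsum_eq_zero_of_not_summable h] at htr
    exact zero_ne_one htr
  have h1 : HasTrace (form σ.1) _ := hasSum_of_eq hs.hasSum (fun k => form_single _ _ _) rfl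
  have hQ := fun i => (hasExpectation_iff _ _ _).1 (hμ i)
  have hS' := fun i => (hasExpectation_iff _ _ _).1 (hS i i)
  have h := (((hS' (Sum.inl j)).add (hS' (Sum.inr j))).add
    (((hQ (Sum.inl j)).smul (2 * μ (Sum.inl j))).add
      ((hQ (Sum.inr j)).smul (2 * μ (Sum.inr j))))).sub
    ((HasExp.one h1).smul (μ (Sum.inl j) * μ (Sum.inl j) + μ (Sum.inr j) * μ (Sum.inr j) : ℂ))
  have h2 := h.of_eq (number_eq_quadratures (E := Module.End ℂ (FiniteFock m)) (annihilation j)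
    (creation j) (quadrature ħ (Sum.inl j)) (quadrature ħ (Sum.inr j)) (Real.sqrt (ħ / 2) : ℂ)
    (μ (Sum.inl j)) (μ (Sum.inr j)) rfl rfl) rfl
  have hc : (2 * ((Real.sqrt (ħ / 2) : ℂ) * (Real.sqrt (ħ / 2) : ℂ))) = (ħ : ℂ) := by
    rw [← Complex.ofReal_mul, Real.mul_self_sqrt (by positivity)]
    push_cast
    ring
  rw [hc] at h2
  have hħ' : (ħ : ℂ) ≠ 0 := Complex.ofReal_ne_zero.2 hħ.ne'
  refine ((h2.summable.mul_left (1 / (2 * ħ) : ℂ)).sub (hs.mul_left (1 / 2 : ℂ))).congr fun k => ?_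
  rw [LinearMap.compl₂_apply, LinearMap.smul_apply, LinearMap.add_apply, Module.End.mul_apply,
    Module.End.mul_apply, annihilation_creation_single, creation_annihilation_single, ← add_smul,
    smul_smul, map_smul, form_single, smul_eq_mul]
  field_simp
  ring

theorem QuantumChannel.isPositive_map {m : ℕ} (Φ : QuantumChannel m) {ρ : TraceClass m}
    (hρ : ρ.1.IsPositive) : (Φ.toLinearMap ρ).1.IsPositive := by
  have h := Φ.completelyPositive 1 (fun _ _ => ρ) (fun ψ => by
    simpa using hρ.inner_nonneg_right (ψ 0))
  rw [ContinuousLinearMap.isPositive_iff_complex]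
  intro x
  have hx : (0 : ℂ) ≤ inner ℂ x ((Φ.toLinearMap ρ).1 x) := by
    have h2 := h (fun _ => x)
    simp only [Finset.univ_unique, Finset.sum_singleton] at h2
    exact h2
  obtain ⟨h1, h2⟩ := Complex.nonneg_iff.1 hx
  rw [← inner_conj_symm, Complex.conj_eq_iff_im.2 h2.symm]
  exact ⟨Complex.ext rfl h2, h1⟩

/-! ### The matrices `X` and `W` -/

theorem swapX_mul_self (m : ℕ) : swapX m * swapX m = 1 := by
  simp [swapX, Matrix.fromBlocks_multiply]

theorem W_conjTranspose_mul (m : ℕ) : (W m)ᴴ * W m = 1 := by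
  have h2 : (Real.sqrt 2 : ℂ)⁻¹ * (Real.sqrt 2 : ℂ)⁻¹ = 1 / 2 := by
    rw [← mul_inv, ← Complex.ofReal_mul, Real.mul_self_sqrt (by norm_num)]
    norm_num
  rw [W, Matrix.conjTranspose_smul, Matrix.smul_mul, Matrix.mul_smul, smul_smul,
    Matrix.fromBlocks_conjTranspose, Matrix.fromBlocks_multiply]
  simp only [one_div, star_inv₀, Complex.star_def, Complex.conj_ofReal, h2,
    Matrix.conjTranspose_smul, Matrix.conjTranspose_one, Matrix.mul_smul, Matrix.mul_one,
    map_neg, Complex.conj_I, smul_smul, neg_mul, mul_neg, neg_neg, Complex.I_mul_I]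
  rw [Matrix.fromBlocks_smul, ← Matrix.fromBlocks_one]
  congr 1 <;> module

theorem W_conjTranspose_transpose (m : ℕ) : ((W m)ᴴ)ᵀ = swapX m * W m := by
  rw [W, swapX, Matrix.conjTranspose_smul, Matrix.transpose_smul, Matrix.mul_smul,
    Matrix.fromBlocks_conjTranspose, Matrix.fromBlocks_transpose, Matrix.fromBlocks_multiply]
  simp [Matrix.conjTranspose_smul]

theorem star_W_mulVec {m : ℕ} (r : Ix m → ℝ) (j : Fin m) :
    star ((W m *ᵥ fun i => (r i : ℂ)) (Sum.inl j)) = (W m *ᵥ fun i => (r i : ℂ)) (Sum.inr j) := by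
  simp [W, Matrix.mulVec, dotProduct, Fintype.sum_sum_type, Matrix.one_apply]

/-- The amplitudes of the coherent state with means `√ħ r`. -/
def coherentCenter {m : ℕ} (r : Ix m → ℝ) (j : Fin m) : ℂ :=
  (W m *ᵥ fun i => (r i : ℂ)) (Sum.inl j)

theorem sumElim_coherentCenter {m : ℕ} (r : Ix m → ℝ) :
    Sum.elim (star (coherentCenter r)) (coherentCenter r) =
      swapX m *ᵥ (W m *ᵥ fun i => (r i : ℂ)) := by
  funext p
  rw [swapX_mulVec]
  rcases p with j | j
  · exact star_W_mulVec r j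
  · rfl

theorem conjTranspose_mul_swapX_mul (m : ℕ) : (W m)ᴴ * swapX m * (swapX m * W m) = 1 := by
  rw [Matrix.mul_assoc, ← Matrix.mul_assoc (swapX m), swapX_mul_self, Matrix.one_mul,
    W_conjTranspose_mul]

/-- Here `A = 0`, so `C = X` and `t = W r`; unitarity of `W` gives the mean `√ħ r` and the vacuum
covariance `ħ/2`. -/
theorem moments_coherent {m : ℕ} {ħ : ℝ} (hħ : 0 ≤ ħ) (r : Ix m → ℝ) :
    HasMean ħ (ketBra (coherentKet (coherentCenter r)) (coherentKet (coherentCenter r)))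
        (Real.sqrt ħ • r) ∧
      HasCovariance ħ (ketBra (coherentKet (coherentCenter r)) (coherentKet (coherentCenter r)))
        (Real.sqrt ħ • r) ((ħ / 2) • 1) := by
  set α := coherentCenter r with hα
  obtain ⟨t, C, ht, hC, hmean, hcov⟩ := exists_gaussian_moments hħ (isPositive_ketBra _)
    (trace_coherent α) Matrix.isSymm_zero (bargmannOp_coherent α) (summable_number_coherent α)
  rw [sub_zero] at ht hC
  have ht' : t = W m *ᵥ fun i => (r i : ℂ) := by
    rw [hα, sumElim_coherentCenter] at ht
    simpa [Matrix.mulVec_mulVec, ← Matrix.mul_assoc, swapX_mul_self] using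
      congrArg (fun v => swapX m *ᵥ v) ht
  have hC' : C = swapX m := by
    simpa [Matrix.mul_assoc, swapX_mul_self] using congrArg (fun D => D * swapX m) hC
  have hm : (fun i => (((Real.sqrt ħ • r) i : ℝ) : ℂ)) = (Real.sqrt ħ : ℂ) • ((W m)ᴴ *ᵥ t) := by
    rw [ht', Matrix.mulVec_mulVec, W_conjTranspose_mul, Matrix.one_mulVec]
    funext i
    simp
  refine ⟨fun i => (hasExpectation_iff _ _ _).2 ?_, fun i j => (hasExpectation_iff _ _ _).2 ?_⟩
  · exact (hmean i).of_eq rfl (congrFun hm i)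
  · refine (hcov _ hm i j).of_eq rfl ?_
    have hX : swapX m - (1 / 2 : ℂ) • swapX m = (1 / 2 : ℂ) • swapX m := by module
    rw [hC', hX, W_conjTranspose_transpose, Matrix.mul_smul, Matrix.smul_mul,
      conjTranspose_mul_swapX_mul, smul_smul]
    by_cases hij : i = j <;> simp [hij, div_eq_mul_inv]

/-! ### The output of a Gaussian channel on a coherent state -/

/-- Freezing the input variables keeps the output quadratic part; the coupling `Γ` only shifts the
linear part. -/
theorem gaussianFun_fromBlocks {ι κ : Type} [Fintype ι] [Fintype κ] (A : Matrix ι ι ℂ)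
    (Γ : Matrix κ ι ℂ) (D : Matrix κ κ ℂ) (b : ι ⊕ κ → ℂ) (c : ℂ) (x : ι → ℂ) (y : κ → ℂ) :
    gaussianFun (Matrix.fromBlocks A Γᵀ Γ D) b c (Sum.elim x y) =
      gaussianFun A ((fun i => b (Sum.inl i)) + Γᵀ *ᵥ y)
        (c * Complex.exp (1 / 2 * (y ⬝ᵥ (D *ᵥ y)) + y ⬝ᵥ fun i => b (Sum.inr i))) x := by
  have hb : b = Sum.elim (fun i => b (Sum.inl i)) (fun i => b (Sum.inr i)) := by
    funext p
    rcases p with j | j <;> rfl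
  have hΓ : y ⬝ᵥ (Γ *ᵥ x) = x ⬝ᵥ (Γᵀ *ᵥ y) := by
    rw [Matrix.mulVec_transpose, dotProduct_comm x, ← Matrix.dotProduct_mulVec]
  rw [gaussianFun, gaussianFun, mul_assoc, ← Complex.exp_add]
  congr 2
  conv_lhs => rw [hb]
  rw [Matrix.fromBlocks_mulVec, sumElim_dotProduct_sumElim, sumElim_dotProduct_sumElim]
  simp only [Sum.elim_comp_inl, Sum.elim_comp_inr, dotProduct_add, hΓ]
  ring

theorem QuantumChannel.HasAbc.bargmannOp_coherent {m : ℕ} {Φ : QuantumChannel m}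
    {A Γ D : Matrix (Ix m) (Ix m) ℂ} {b : Ix m ⊕ Ix m → ℂ} {c : ℂ}
    (h : Φ.HasAbc (Matrix.fromBlocks A Γᵀ Γ D) b c) (α : Fin m → ℂ) :
    ∃ c', ∀ w z, bargmannOp (Φ.toLinearMap (ketBra (coherentKet α) (coherentKet α))) w z =
      gaussianFun A ((fun i => b (Sum.inl i)) + Γᵀ *ᵥ Sum.elim (star α) α) c' (Sum.elim w z) := by
  refine ⟨(bargmannFactor (star α) * bargmannFactor α)⁻¹ * (c * Complex.exp
    (1 / 2 * (Sum.elim (star α) α ⬝ᵥ (D *ᵥ Sum.elim (star α) α)) +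
      Sum.elim (star α) α ⬝ᵥ fun i => b (Sum.inr i))), fun w z => ?_⟩
  have h1 := h.2 w z (star α) α
  rw [bargmannMap, star_star, gaussianFun_fromBlocks] at h1
  have h0 := mul_ne_zero (bargmannFactor_ne_zero (star α)) (bargmannFactor_ne_zero α)
  rw [gaussianFun, mul_assoc, ← gaussianFun, ← h1, ← mul_assoc, inv_mul_cancel₀ h0, one_mul]

/-- The output moments are computed both from the phase-space form and from the Bargmann parameters;
uniqueness of sums equates them. -/
theorem QuantumChannel.output_moments {m : ℕ} {ħ : ℝ} (hħ : 0 < ħ) {Φ : QuantumChannel m}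
    {A Γ D : Matrix (Ix m) (Ix m) ℂ} {b : Ix m ⊕ Ix m → ℂ} {c : ℂ}
    (hA : Φ.HasAbc (Matrix.fromBlocks A Γᵀ Γ D) b c) {XΦ YΦ : Matrix (Ix m) (Ix m) ℝ}
    {d : Ix m → ℝ} (hXY : Φ.HasPhaseSpaceForm ħ XΦ YΦ d) (r : Ix m → ℝ) :
    IsUnit (swapX m - A) ∧
      (fun i => (((XΦ *ᵥ (Real.sqrt ħ • r) + d) i : ℝ) : ℂ)) =
        (Real.sqrt ħ : ℂ) • ((W m)ᴴ *ᵥ ((swapX m - A)⁻¹ *ᵥ ((fun i => b (Sum.inl i)) +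
          Γᵀ *ᵥ (swapX m *ᵥ (W m *ᵥ fun i => (r i : ℂ)))))) ∧
      (XΦ * ((ħ / 2) • 1) * XΦᵀ + YΦ).map Complex.ofReal =
        (ħ : ℂ) • ((W m)ᴴ * ((swapX m - A)⁻¹ - (1 / 2 : ℂ) • swapX m) * (swapX m * W m)) := by
  set α := coherentCenter r with hα
  obtain ⟨hmean, hcov⟩ := moments_coherent hħ.le r
  obtain ⟨hmean', hcov'⟩ := hXY _ _ _ (isGaussianState_coherent α) hmean hcov
  obtain ⟨c', hc'⟩ := hA.bargmannOp_coherent α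
  have htr : trace (Φ.toLinearMap (ketBra (coherentKet α) (coherentKet α))) = 1 := by
    rw [Φ.tracePreserving, trace_coherent]
  have hAsymm : A.IsSymm := (Matrix.isSymm_fromBlocks_iff.1 hA.1).1
  obtain ⟨t, C, ht, hC, hm, hS⟩ := exists_gaussian_moments hħ.le
    (Φ.isPositive_map (isPositive_ketBra _)) htr hAsymm hc'
    (summable_number_of_hasCovariance hħ htr hmean' hcov')
  have hinv : (swapX m - A)⁻¹ = C := Matrix.inv_eq_left_inv hC
  have htC : t = C *ᵥ ((fun i => b (Sum.inl i)) +
      Γᵀ *ᵥ (swapX m *ᵥ (W m *ᵥ fun i => (r i : ℂ)))) := by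
    rw [hα, sumElim_coherentCenter] at ht
    rw [← ht, Matrix.mulVec_mulVec, hC, Matrix.one_mulVec]
  have hmeq : (fun i => (((XΦ *ᵥ (Real.sqrt ħ • r) + d) i : ℝ) : ℂ)) =
      (Real.sqrt ħ : ℂ) • ((W m)ᴴ *ᵥ t) :=
    funext fun i => ((hasExpectation_iff _ _ _).1 (hmean' i)).unique (hm i)
  refine ⟨(Matrix.isUnit_iff_isUnit_det _).2 (Matrix.isUnit_det_of_left_inverse hC), ?_, ?_⟩
  · rw [hinv, ← htC, hmeq]
  · rw [hinv, ← W_conjTranspose_transpose]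
    ext i j
    exact ((hasExpectation_iff _ _ _).1 (hcov' i j)).unique (hS _ hmeq i j)

/-- The standard basis vectors are real, so real phase-space displacements suffice to determine a
complex matrix. -/
theorem matrix_eq_of_mulVec_real {ι κ : Type*} [Fintype κ] [DecidableEq κ] {M N : Matrix ι κ ℂ}
    (h : ∀ r : κ → ℝ, (M *ᵥ fun i => (r i : ℂ)) = N *ᵥ fun i => (r i : ℂ)) : M = N := by
  refine Matrix.ext_of_mulVec_single fun j => ?_
  have h1 : (fun i => ((Pi.single j 1 : κ → ℝ) i : ℂ)) = Pi.single j 1 := by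
    funext i
    simp [Pi.single_apply, apply_ite]
  rw [← h1]
  exact h _

end

end Bargmann

/-! ### The phase-space form from the Bargmann parameters -/

theorem mainTheorem11 (m : ℕ) (ħ : ℝ) (hħ : 0 < ħ) (Φ : Bargmann.QuantumChannel m)
    (Aout Γ Ain : Matrix (Bargmann.Ix m) (Bargmann.Ix m) ℂ)
    (b : Bargmann.Ix m ⊕ Bargmann.Ix m → ℂ) (c : ℂ)
    (hA : Φ.HasAbc (Matrix.fromBlocks Aout Γᵀ Γ Ain) b c)
    (XΦ YΦ : Matrix (Bargmann.Ix m) (Bargmann.Ix m) ℝ) (d : Bargmann.Ix m → ℝ)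
    (hXY : Φ.HasPhaseSpaceForm ħ XΦ YΦ d) :
    IsUnit (1 - Bargmann.swapX m * Aout) ∧
    XΦ.map Complex.ofReal =
      (Bargmann.W m)ᴴ * (1 - Bargmann.swapX m * Aout)⁻¹ * Bargmann.swapX m * Γᵀ *
        Bargmann.swapX m * Bargmann.W m ∧
    (1 / (ħ : ℂ)) • YΦ.map Complex.ofReal =
      (Bargmann.W m)ᴴ * (1 - Bargmann.swapX m * Aout)⁻¹ * Bargmann.W m -
        (1 / 2 : ℂ) • (1 + XΦ.map Complex.ofReal * (XΦ.map Complex.ofReal)ᵀ) := by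
  have hout := Bargmann.QuantumChannel.output_moments hħ hA hXY
  -- The vacuum input `r = 0` gives invertibility, the displacement `d`, and the covariance
  -- equation, which does not depend on `r`.
  obtain ⟨hunit, hd, hY⟩ := hout 0
  have hXX := Bargmann.swapX_mul_self m
  have hfac : 1 - Bargmann.swapX m * Aout =
      Bargmann.swapX m * (Bargmann.swapX m - Aout) := by
    rw [Matrix.mul_sub, hXX]
  have hXunit : IsUnit (Bargmann.swapX m) := ⟨⟨_, _, hXX, hXX⟩, rfl⟩
  have hinv : (1 - Bargmann.swapX m * Aout)⁻¹ =
      (Bargmann.swapX m - Aout)⁻¹ * Bargmann.swapX m := by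
    rw [hfac, Matrix.mul_inv_rev, Matrix.inv_eq_left_inv hXX]
  have hħ' : (ħ : ℂ) ≠ 0 := Complex.ofReal_ne_zero.2 hħ.ne'
  have hs : (Real.sqrt ħ : ℂ) ≠ 0 := Complex.ofReal_ne_zero.2 (Real.sqrt_pos.2 hħ).ne'
  refine ⟨hfac ▸ hXunit.mul hunit, ?_, ?_⟩
  · refine Bargmann.matrix_eq_of_mulVec_real fun r => ?_
    obtain ⟨-, hr, -⟩ := hout r
    have h0 : (fun i => (((0 : Bargmann.Ix m → ℝ) i : ℝ) : ℂ)) = 0 := by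
      funext i
      simp
    rw [h0] at hd
    simp only [smul_zero, Matrix.mulVec_zero, zero_add, add_zero] at hd
    have hreal : (fun i => (((XΦ *ᵥ (Real.sqrt ħ • r) + d) i : ℝ) : ℂ)) =
        (Real.sqrt ħ : ℂ) • (XΦ.map Complex.ofReal *ᵥ fun i => (r i : ℂ)) +
          fun i => (d i : ℂ) := by
      funext i
      rw [Matrix.mulVec_smul]
      simp [Matrix.mulVec, dotProduct, mul_add]
    -- Subtracting the vacuum equation removes `d` and `b`, leaving an identity linear in `r`.
    rw [hreal, Matrix.mulVec_add, Matrix.mulVec_add, smul_add, ← hd, add_comm,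
      add_right_inj] at hr
    rw [hinv, smul_right_injective _ hs hr]
    simp only [Matrix.mulVec_mulVec, Matrix.mul_assoc]
    rw [← Matrix.mul_assoc (Bargmann.swapX m) (Bargmann.swapX m), hXX, Matrix.one_mul]
  · have hmap : (XΦ * ((ħ / 2) • 1) * XΦᵀ + YΦ).map Complex.ofReal =
        (ħ / 2 : ℂ) • (XΦ.map Complex.ofReal * (XΦ.map Complex.ofReal)ᵀ) +
          YΦ.map Complex.ofReal := by
      ext i j
      simp [Matrix.mul_apply]
    have hW : (Bargmann.W m)ᴴ * ((Bargmann.swapX m - Aout)⁻¹ - (1 / 2 : ℂ) • Bargmann.swapX m) *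
        (Bargmann.swapX m * Bargmann.W m) =
        (Bargmann.W m)ᴴ * (1 - Bargmann.swapX m * Aout)⁻¹ * Bargmann.W m - (1 / 2 : ℂ) • 1 := by
      rw [hinv, Matrix.mul_sub, Matrix.sub_mul, Matrix.mul_smul, Matrix.smul_mul,
        Bargmann.conjTranspose_mul_swapX_mul]
      simp only [Matrix.mul_assoc]
    rw [hmap, hW] at hY
    rw [eq_sub_of_add_eq' hY, smul_sub, smul_smul, smul_smul, one_div_mul_cancel hħ', one_smul,
      show (1 / (ħ : ℂ)) * (ħ / 2) = 1 / 2 by field_simp, smul_add, sub_sub]
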